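/- \textbf{Setting.} Let $G$ be a (finite-dimensional, smooth, real) Lie group with neutral element $e$ and $\mathfrak g=T_eG$. A \emph{Dirac structure} on $G$ is a smooth vector subbundle $\mathsf D\subseteq TG\oplus T^*G$ that is equal, fibrewise, to its own orthogonal with respect to the pairing $\langle(v,\alpha),(w,\beta)\rangle=\beta(v)+\alpha(w)$; no integrability is required. It is \emph{multiplicative}, and $(G,\mathsf D)$ is a \emph{Dirac Lie group}, if the multiplication $m:(G\times G,\mathsf D\oplus\mathsf D)\to(G,\mathsf D)$ is a forward Dirac map: for all $g,h\in G$ and $(v,\alpha)\in\mathsf D(gh)$ there are $(w,\beta)\in\mathsf D(g)$ and $(u,\gamma)\in\mathsf D(h)$ with $T_{(g,h)}m(w,u)=v$ and $(\beta,\gamma)=(T_{(g,h)}m)^*\alpha$. Put $$\mathsf G_0(g)=\{v\in T_gG\mid (v,0)\in\mathsf D(g)\},\qquad \mathsf P_1(g)=\{\alpha\in T_g^*G\mid \exists\, v\in T_gG:\ (v,\alpha)\in\mathsf D(g)\},\qquad \mathfrak p_1=\mathsf P_1(e)\subseteq\mathfrak g^*.$$ Let $N\subseteq G$ be the integral leaf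 of the distribution $\mathsf G_0$ through $e$, that is, the largest connected injectively immersed submanifold through $e$ whose tangent spaces are the fibres of $\mathsf G_0$. For $\xi\in\mathfrak g^*$ let $\xi^L$ be the left invariant one-form with $\xi^L(e)=\xi$. For $\xi,\eta\in\mathfrak p_1$ set $$[\xi,\eta]=\mathbf d_e\bigl(\eta^L(X_\xi)\bigr)\in\mathfrak g^*,$$ where $X_\xi$ is a smooth vector field, defined near $e$, such that $(X_\xi,\xi^L)$ is a local section of $\mathsf D$. A diffeomorphism $\varphi$ of $G$ \emph{preserves} $\mathsf D$ if $(\varphi^*X,\varphi^*\alpha)$ is a smooth local section of $\mathsf D$ for every smooth local section $(X,\alpha)$ of $\mathsf D$. \textbf{Theorem.} Let $(G,\mathsf D)$ be a Dirac Lie group. For all $\xi,\eta\in\mathfrak p_1$ a vector field $X_\xi$ as above exists and $[\xi,\eta]$ does not depend on its choice. The following are equivalent: \begin{enumerate} \item[(i)] $\mathsf D$ is invariant under the right action of $N$: every right translation $R_n:g\mapsto gn$, $n\in N$, preserves $\mathsf D$; \item[(ii)] $\mathsf D$ is invariant under the left action of $N$: every left translation $L_n:g\mapsto ng$, $n\in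 N$, preserves $\mathsf D$; \item[(iii)] $[\xi,\eta]\in\mathfrak p_1$ for all $\xi,\eta\in\mathfrak p_1$. \end{enumerate} -/

import Mathlib

open scoped Manifold ContDiff

universe u

noncomputable section

section Manifold

variable {E : Type*} [NormedAddCommGroup E] [NormedSpace ℝ E]
  {H : Type*} [TopologicalSpace H] (I : ModelWithCorners ℝ E H)
  {M : Type u} [TopologicalSpace M] [ChartedSpace H M]

/-- The cotangent space `T*_m M`. -/
abbrev CotangentFiber (m : M) : Type _ := TangentSpace I m →L[ℝ] ℝ

/-- The fibre `T_m M ⊕ T*_m M` of the Pontryagin bundle. -/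
abbrev PontryaginFiber (m : M) : Type _ := TangentSpace I m × CotangentFiber I m

variable {I}

/-- The symmetric pairing `⟨(v, α), (w, β)⟩ = β v + α w` on a fibre of the Pontryagin bundle. -/
def pontryaginPairing {m : M} (a b : PontryaginFiber I m) : ℝ := b.2 a.1 + a.2 b.1

/-- The vector field `X` is smooth on `U`. -/
def IsSmoothFieldOn [IsManifold I ∞ M] (U : Set M) (X : ∀ m : M, TangentSpace I m) : Prop :=
  ContMDiffOn I I.tangent ∞ (fun m => (⟨m, X m⟩ : TangentBundle I M)) U

/-- The one-form `α` is smooth on `U`, as a section of the cotangent bundle (the bundle of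
continuous linear maps from the tangent bundle to the trivial line bundle). -/
def IsSmoothFormOn [IsManifold I ∞ M] (U : Set M) (α : ∀ m : M, CotangentFiber I m) : Prop :=
  ContMDiffOn I (I.prod 𝓘(ℝ, E →L[ℝ] ℝ)) ∞
    (fun m => Bundle.TotalSpace.mk' (E →L[ℝ] ℝ)
      (E := fun m : M => TangentSpace I m →L[ℝ] Bundle.Trivial M ℝ m) m (α m)) U

/-- A Dirac structure on `M`: a smooth vector subbundle `D` of the Pontryagin bundle
`TM ⊕ T*M` that is Lagrangian, that is, equal to its own orthogonal for the pairing. -/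
structure DiracStructure (I : ModelWithCorners ℝ E H) (M : Type u) [TopologicalSpace M]
    [ChartedSpace H M] [IsManifold I ∞ M] where
  /-- The fibre of the subbundle over a point. -/
  fiber : ∀ m : M, Submodule ℝ (PontryaginFiber I m)
  /-- The subbundle has a smooth frame near each point. -/
  exists_local_frame : ∀ m : M, ∃ U : Set M, IsOpen U ∧ m ∈ U ∧
    ∃ (k : ℕ) (X : Fin k → ∀ p : M, TangentSpace I p) (α : Fin k → ∀ p : M, CotangentFiber I p),
      (∀ i, IsSmoothFieldOn U (X i)) ∧ (∀ i, IsSmoothFormOn U (α i)) ∧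
      ∀ p ∈ U, LinearIndependent ℝ (fun i => ((X i p, α i p) : PontryaginFiber I p)) ∧
        Submodule.span ℝ (Set.range fun i => ((X i p, α i p) : PontryaginFiber I p)) = fiber p
  /-- Each fibre is its own orthogonal. -/
  lagrangian : ∀ (m : M) (a : PontryaginFiber I m),
    a ∈ fiber m ↔ ∀ b ∈ fiber m, pontryaginPairing a b = 0

namespace DiracStructure

variable [IsManifold I ∞ M] (D : DiracStructure I M)

/-- `(X, α) ∈ Γ(D)`, with domain the open set `U`: a smooth local section of `D`. -/
def IsSection (U : Set M) (X : ∀ m : M, TangentSpace I m) (α : ∀ m : M, CotangentFiber I m) :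
    Prop :=
  IsOpen U ∧ IsSmoothFieldOn U X ∧ IsSmoothFormOn U α ∧
    ∀ m ∈ U, ((X m, α m) : PontryaginFiber I m) ∈ D.fiber m

/-- The characteristic distribution `G₀(m) = {v | (v, 0) ∈ D(m)}`. -/
def G₀ (m : M) : Submodule ℝ (TangentSpace I m) :=
  (D.fiber m).comap (LinearMap.inl ℝ (TangentSpace I m) (CotangentFiber I m))

/-- The characteristic codistribution `P₁(m) = {α | ∃ v, (v, α) ∈ D(m)}`. -/
def P₁ (m : M) : Submodule ℝ (CotangentFiber I m) :=
  (D.fiber m).map (LinearMap.snd ℝ (TangentSpace I m) (CotangentFiber I m))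

/-- The diffeomorphism `φ` of `M` preserves `D`: if `(X, α)` is a local section of `D`,
then so is `(φ^* X, φ^* α)`. -/
def IsPreservedBy (φ : M → M) : Prop :=
  ∀ (U : Set M) (X : ∀ m : M, TangentSpace I m) (α : ∀ m : M, CotangentFiber I m),
    D.IsSection U X α →
      D.IsSection (φ ⁻¹' U) (VectorField.mpullback I I φ X)
        (fun m => (α (φ m)).comp (mfderiv I I φ m))

end DiracStructure

/-- `ι : S → M` is a connected integral manifold of the distribution `Δ`: an injective smooth
immersion of a connected `k`-dimensional manifold with `T ι (T_s S) = Δ (ι s)` for all `s`. -/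
structure IsConnectedIntegralManifold (Δ : ∀ m : M, Submodule ℝ (TangentSpace I m))
    {k : ℕ} {S : Type*} [TopologicalSpace S] [ChartedSpace (EuclideanSpace ℝ (Fin k)) S]
    (ι : S → M) : Prop where
  isManifold : IsManifold (𝓡 k) ∞ S
  t2Space : T2Space S
  secondCountableTopology : SecondCountableTopology S
  connectedSpace : ConnectedSpace S
  contMDiff : ContMDiff (𝓡 k) I ∞ ι
  injective : Function.Injective ι
  injective_mfderiv : ∀ s, Function.Injective (mfderiv (𝓡 k) I ι s)
  range_mfderiv : ∀ s, Set.range (mfderiv (𝓡 k) I ι s) = (Δ (ι s) : Set (TangentSpace I (ι s)))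

/-- The integral leaf through `x` of an (integrable) distribution `Δ`: the union of all connected
integral manifolds of `Δ` through `x`, that is, the underlying set of the largest one. -/
def integralLeaf (Δ : ∀ m : M, Submodule ℝ (TangentSpace I m)) (x : M) : Set M :=
  {y | ∃ (k : ℕ) (S : Type u) (_ : TopologicalSpace S)
    (_ : ChartedSpace (EuclideanSpace ℝ (Fin k)) S) (ι : S → M),
      IsConnectedIntegralManifold (k := k) Δ ι ∧ x ∈ Set.range ι ∧ y ∈ Set.range ι}

/-- The fibres `D(p) ⊕ D'(q)` of the product of two Dirac structures, under the identification
`T_(p,q)(M × M') = T_p M × T_q M'`. -/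
def productDiracFiber {E' : Type*} [NormedAddCommGroup E'] [NormedSpace ℝ E']
    {H' : Type*} [TopologicalSpace H'] {I' : ModelWithCorners ℝ E' H'}
    {M' : Type*} [TopologicalSpace M'] [ChartedSpace H' M']
    (D : ∀ p : M, Submodule ℝ (PontryaginFiber I p))
    (D' : ∀ q : M', Submodule ℝ (PontryaginFiber I' q)) (x : M × M') :
    Set (PontryaginFiber (I.prod I') x) :=
  {a | ((a.1.1, a.2.comp (ContinuousLinearMap.inl ℝ (TangentSpace I x.1) (TangentSpace I' x.2))) :
          PontryaginFiber I x.1) ∈ D x.1 ∧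
       ((a.1.2, a.2.comp (ContinuousLinearMap.inr ℝ (TangentSpace I x.1) (TangentSpace I' x.2))) :
          PontryaginFiber I' x.2) ∈ D' x.2}

/-- `φ : M → M'` is a forward Dirac map for the families `D` and `D'` of Dirac subspaces: every
`(w, β) ∈ D'(φ m)` has a `v ∈ T_m M` with `T φ v = w` and `(v, φ^* β) ∈ D(m)`. -/
def IsForwardDirac {E' : Type*} [NormedAddCommGroup E'] [NormedSpace ℝ E']
    {H' : Type*} [TopologicalSpace H'] {I' : ModelWithCorners ℝ E' H'}
    {M' : Type*} [TopologicalSpace M'] [ChartedSpace H' M']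
    (D : ∀ p : M, Set (PontryaginFiber I p))
    (D' : ∀ q : M', Set (PontryaginFiber I' q)) (φ : M → M') : Prop :=
  ∀ (m : M), ∀ b ∈ D' (φ m), ∃ v : TangentSpace I m, mfderiv I I' φ m v = b.1 ∧
    ((v, b.2.comp (mfderiv I I' φ m)) : PontryaginFiber I m) ∈ D m

end Manifold

section LieGroup

variable {E : Type*} [NormedAddCommGroup E] [NormedSpace ℝ E]
  {H : Type*} [TopologicalSpace H] {I : ModelWithCorners ℝ E H}
  {G : Type u} [TopologicalSpace G] [ChartedSpace H G] [Group G]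

/-- The left invariant one-form `ξ^L(g) = (T_g L_{g⁻¹})^* ξ` with value `ξ ∈ 𝔤^*` at `e`. -/
def leftInvariantForm (ξ : CotangentFiber I (1 : G)) (g : G) : CotangentFiber I g :=
  ContinuousLinearMap.comp (M₂ := TangentSpace I (g⁻¹ * g)) ξ
    (mfderiv I I (fun h : G => g⁻¹ * h) g)

namespace DiracStructure

variable [LieGroup I ∞ G] (D : DiracStructure I G)

/-- `(G, D)` is a Dirac Lie group: the multiplication is a forward Dirac map
`(G × G, D ⊕ D) → (G, D)`. -/
def IsMultiplicative : Prop :=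
  IsForwardDirac (I := I.prod I) (I' := I) (productDiracFiber D.fiber D.fiber)
    (fun g => (D.fiber g : Set (PontryaginFiber I g))) (fun x : G × G => x.1 * x.2)

/-- `X` is a vector field `X_ξ`, defined near `e`: `(X, ξ^L)` is a local section of `D`. -/
def IsLift (ξ : CotangentFiber I (1 : G)) (X : ∀ g : G, TangentSpace I g) : Prop :=
  ∃ U : Set G, (1 : G) ∈ U ∧ D.IsSection U X (leftInvariantForm ξ)

open Classical in
/-- The bracket `[ξ, η] = d_e (η^L(X_ξ)) ∈ 𝔤^*`, where `X_ξ` is any vector field near `e` with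
`(X_ξ, ξ^L) ∈ Γ(D)` (the default value `0` stands where there is none, that is, for `ξ ∉ 𝔭₁`). -/
def dualBracket (ξ η : CotangentFiber I (1 : G)) : CotangentFiber I (1 : G) :=
  if h : ∃ X, D.IsLift ξ X then
    mfderiv I 𝓘(ℝ, ℝ) (fun g : G => leftInvariantForm η g (h.choose g)) 1
  else 0

end DiracStructure

end LieGroup

end

noncomputable section

section ModelDerivative

variable {E : Type*} [NormedAddCommGroup E] [NormedSpace ℝ E]
  {H : Type*} [TopologicalSpace H] (I : ModelWithCorners ℝ E H)
  {M : Type*} [TopologicalSpace M] [ChartedSpace H M]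
  {E' : Type*} [NormedAddCommGroup E'] [NormedSpace ℝ E']
  {H' : Type*} [TopologicalSpace H'] (I' : ModelWithCorners ℝ E' H')
  {M' : Type*} [TopologicalSpace M'] [ChartedSpace H' M']
  {E'' : Type*} [NormedAddCommGroup E''] [NormedSpace ℝ E'']
  {H'' : Type*} [TopologicalSpace H''] (I'' : ModelWithCorners ℝ E'' H'')
  {M'' : Type*} [TopologicalSpace M''] [ChartedSpace H'' M'']

/-- The derivative `mfderiv`, as a map of the model spaces. -/
def modelMFDeriv (f : M → M') (x : M) : E →L[ℝ] E' := mfderiv I I' f x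

theorem modelMFDeriv_comp {g : M' → M''} {f : M → M'} (x : M)
    (hg : MDifferentiableAt I' I'' g (f x)) (hf : MDifferentiableAt I I' f x) :
    modelMFDeriv I I'' (fun y => g (f y)) x =
      (modelMFDeriv I' I'' g (f x)).comp (modelMFDeriv I I' f x) :=
  mfderiv_comp (I' := I') x hg hf

theorem modelMFDeriv_id (x : M) : modelMFDeriv I I (fun y : M => y) x = .id ℝ E :=
  mfderiv_id

end ModelDerivative

section Translations

variable {E : Type*} [NormedAddCommGroup E] [NormedSpace ℝ E]
  {H : Type*} [TopologicalSpace H] (I : ModelWithCorners ℝ E H)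
  {G : Type u} [TopologicalSpace G] [ChartedSpace H G] [Group G]

/-- The derivative at `h` of the left translation by `g`, on the model space. -/
def leftDeriv (g h : G) : E →L[ℝ] E := modelMFDeriv I I (fun x : G => g * x) h

/-- The derivative at `g` of the right translation by `h`, on the model space. -/
def rightDeriv (h g : G) : E →L[ℝ] E := modelMFDeriv I I (fun x : G => x * h) g

variable [LieGroup I ∞ G]

theorem mdifferentiableAt_mul_left' (g h : G) :
    MDifferentiableAt I I (fun x : G => g * x) h :=
  (contMDiff_mul_left (I := I) (n := ∞)).contMDiffAt.mdifferentiableAt (by simp)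

theorem mdifferentiableAt_mul_right' (h g : G) :
    MDifferentiableAt I I (fun x : G => x * h) g :=
  (contMDiff_mul_right (I := I) (n := ∞)).contMDiffAt.mdifferentiableAt (by simp)

theorem leftDeriv_comp (g h k : G) :
    (leftDeriv I g (h * k)).comp (leftDeriv I h k) = leftDeriv I (g * h) k := by
  have := modelMFDeriv_comp I I I k (mdifferentiableAt_mul_left' I g (h * k))
    (mdifferentiableAt_mul_left' I h k)
  simp only [← mul_assoc] at this
  exact this.symm

theorem rightDeriv_comp (k h g : G) :
    (rightDeriv I k (g * h)).comp (rightDeriv I h g) = rightDeriv I (h * k) g := by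
  have := modelMFDeriv_comp I I I g (mdifferentiableAt_mul_right' I k (g * h))
    (mdifferentiableAt_mul_right' I h g)
  simp only [mul_assoc] at this
  exact this.symm

theorem leftDeriv_comp_rightDeriv (g h k : G) :
    (leftDeriv I g (h * k)).comp (rightDeriv I k h) =
      (rightDeriv I k (g * h)).comp (leftDeriv I g h) := by
  have h1 := modelMFDeriv_comp I I I h (mdifferentiableAt_mul_left' I g (h * k))
    (mdifferentiableAt_mul_right' I k h)
  have h2 := modelMFDeriv_comp I I I h (mdifferentiableAt_mul_right' I k (g * h))
    (mdifferentiableAt_mul_left' I g h)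
  simp only [← mul_assoc] at h1
  exact h1.symm.trans h2

omit [LieGroup I ∞ G] in
theorem leftDeriv_one (h : G) : leftDeriv I (1 : G) h = .id ℝ E := by
  simp only [leftDeriv, one_mul, modelMFDeriv_id]

omit [LieGroup I ∞ G] in
theorem rightDeriv_one (g : G) : rightDeriv I (1 : G) g = .id ℝ E := by
  simp only [rightDeriv, mul_one, modelMFDeriv_id]

theorem leftDeriv_inv_comp (g h : G) :
    (leftDeriv I g⁻¹ (g * h)).comp (leftDeriv I g h) = .id ℝ E := by
  rw [leftDeriv_comp, inv_mul_cancel, leftDeriv_one]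

theorem leftDeriv_comp_inv (g h : G) :
    (leftDeriv I g h).comp (leftDeriv I g⁻¹ (g * h)) = .id ℝ E := by
  have := leftDeriv_comp I g g⁻¹ (g * h)
  rwa [inv_mul_cancel_left, mul_inv_cancel, leftDeriv_one] at this

theorem rightDeriv_inv_comp (h g : G) :
    (rightDeriv I h⁻¹ (g * h)).comp (rightDeriv I h g) = .id ℝ E := by
  rw [rightDeriv_comp, mul_inv_cancel, rightDeriv_one]

theorem rightDeriv_comp_inv (h g : G) :
    (rightDeriv I h g).comp (rightDeriv I h⁻¹ (g * h)) = .id ℝ E := by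
  have := rightDeriv_comp I h h⁻¹ (g * h)
  rwa [mul_inv_cancel_right, inv_mul_cancel, rightDeriv_one] at this

theorem mfderiv_mul_eq (g h : G) :
    modelMFDeriv (I.prod I) I (fun x : G × G => x.1 * x.2) (g, h) =
      (rightDeriv I h g).comp (.fst ℝ E E) + (leftDeriv I g h).comp (.snd ℝ E E) :=
  mfderiv_prod_eq_add_comp ((contMDiff_mul I ∞).contMDiffAt.mdifferentiableAt (by simp))

end Translations

namespace DiracStructure

section Pointwise

variable {E : Type*} [NormedAddCommGroup E] [NormedSpace ℝ E]
  {H : Type*} [TopologicalSpace H] {I : ModelWithCorners ℝ E H}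
  {M : Type u} [TopologicalSpace M] [ChartedSpace H M] [IsManifold I ∞ M]
  (D : DiracStructure I M)

/-- The fibre of `D`, as a subspace of `E × E*`. -/
def modelFiber (m : M) : Submodule ℝ (E × (E →L[ℝ] ℝ)) := D.fiber m

/-- The characteristic distribution, as a family of subspaces of `E`. -/
def modelG₀ (m : M) : Submodule ℝ E := D.G₀ m

/-- The characteristic codistribution, as a family of subspaces of `E*`. -/
def modelP₁ (m : M) : Submodule ℝ (E →L[ℝ] ℝ) := D.P₁ m

variable {D}

theorem mem_modelG₀ {m : M} {v : E} : v ∈ D.modelG₀ m ↔ (v, (0 : E →L[ℝ] ℝ)) ∈ D.modelFiber m :=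
  Iff.rfl

theorem mem_modelP₁ {m : M} {α : E →L[ℝ] ℝ} :
    α ∈ D.modelP₁ m ↔ ∃ v, (v, α) ∈ D.modelFiber m := by
  constructor
  · rintro ⟨⟨v, β⟩, h, rfl⟩
    exact ⟨v, h⟩
  · rintro ⟨v, h⟩
    exact ⟨(v, α), h, rfl⟩

theorem mem_modelFiber_iff {m : M} {v : E} {α : E →L[ℝ] ℝ} :
    (v, α) ∈ D.modelFiber m ↔ ∀ w β, (w, β) ∈ D.modelFiber m → β v + α w = 0 :=
  (D.lagrangian m (v, α)).trans ⟨fun h w β hb => h (w, β) hb, fun h b hb => h b.1 b.2 hb⟩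

theorem mem_modelG₀_iff {m : M} {v : E} :
    v ∈ D.modelG₀ m ↔ ∀ β ∈ D.modelP₁ m, β v = 0 := by
  rw [mem_modelG₀, mem_modelFiber_iff]
  constructor
  · intro h β hβ
    obtain ⟨w, hw⟩ := mem_modelP₁.1 hβ
    simpa using h w β hw
  · intro h w β hw
    simpa using h β (mem_modelP₁.2 ⟨w, hw⟩)

theorem mem_modelP₁_iff [FiniteDimensional ℝ E] {m : M} {α : E →L[ℝ] ℝ} :
    α ∈ D.modelP₁ m ↔ ∀ v ∈ D.modelG₀ m, α v = 0 := by
  refine ⟨fun h v hv => mem_modelG₀_iff.1 hv α h, fun h => ?_⟩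
  by_contra hα
  obtain ⟨f, hf, hfP⟩ := Submodule.exists_le_ker_of_notMem hα
  let f' : Module.Dual ℝ (Module.Dual ℝ E) :=
    f.comp (LinearMap.toContinuousLinearMap (𝕜 := ℝ) (E := E) (F' := ℝ)).toLinearMap
  obtain ⟨v, hv⟩ := (Module.evalEquiv ℝ E).surjective f'
  have key : ∀ β : E →L[ℝ] ℝ, f β = β v := by
    intro β
    have := congrArg (fun φ => φ (β : E →ₗ[ℝ] ℝ)) hv
    simp only [Module.evalEquiv_apply, Module.Dual.eval_apply] at this
    exact this.symm
  refine hf ?_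
  rw [key]
  exact h v (mem_modelG₀_iff.2 fun β hβ => (key β).symm.trans (hfP hβ))

end Pointwise

section Multiplicative

variable {E : Type*} [NormedAddCommGroup E] [NormedSpace ℝ E]
  {H : Type*} [TopologicalSpace H] {I : ModelWithCorners ℝ E H}
  {G : Type u} [TopologicalSpace G] [ChartedSpace H G] [Group G] [LieGroup I ∞ G]
  {D : DiracStructure I G}

theorem IsMultiplicative.exists_decomp (hD : D.IsMultiplicative) {g h : G} {v : E}
    {α : E →L[ℝ] ℝ} (hv : (v, α) ∈ D.modelFiber (g * h)) :
    ∃ w u : E, rightDeriv I h g w + leftDeriv I g h u = v ∧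
      (w, α.comp (rightDeriv I h g)) ∈ D.modelFiber g ∧
      (u, α.comp (leftDeriv I g h)) ∈ D.modelFiber h := by
  obtain ⟨wu, h1, h2, h3⟩ := hD (g, h) (v, α) hv
  have key := mfderiv_mul_eq I g h
  refine ⟨wu.1, wu.2, ?_, ?_, ?_⟩
  · have := DFunLike.congr_fun key wu
    exact this.symm.trans h1
  · have : (α.comp (modelMFDeriv (I.prod I) I (fun x : G × G => x.1 * x.2) (g, h))).comp
        (.inl ℝ E E) = α.comp (rightDeriv I h g) := by
      rw [key]; ext x; simp
    rw [← this]
    exact h2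
  · have : (α.comp (modelMFDeriv (I.prod I) I (fun x : G × G => x.1 * x.2) (g, h))).comp
        (.inr ℝ E E) = α.comp (leftDeriv I g h) := by
      rw [key]; ext x; simp
    rw [← this]
    exact h3

variable (hD : D.IsMultiplicative)
include hD

theorem IsMultiplicative.comp_leftDeriv_mem {g h : G} {α : E →L[ℝ] ℝ}
    (hα : α ∈ D.modelP₁ (g * h)) : α.comp (leftDeriv I g h) ∈ D.modelP₁ h := by
  obtain ⟨v, hv⟩ := mem_modelP₁.1 hα
  obtain ⟨w, u, -, -, hu⟩ := hD.exists_decomp hv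
  exact mem_modelP₁.2 ⟨u, hu⟩

theorem IsMultiplicative.comp_rightDeriv_mem {g h : G} {α : E →L[ℝ] ℝ}
    (hα : α ∈ D.modelP₁ (g * h)) : α.comp (rightDeriv I h g) ∈ D.modelP₁ g := by
  obtain ⟨v, hv⟩ := mem_modelP₁.1 hα
  obtain ⟨w, u, -, hw, -⟩ := hD.exists_decomp hv
  exact mem_modelP₁.2 ⟨w, hw⟩

theorem IsMultiplicative.leftDeriv_mem (g : G) {h : G} {v : E} (hv : v ∈ D.modelG₀ h) :
    leftDeriv I g h v ∈ D.modelG₀ (g * h) :=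
  mem_modelG₀_iff.2 fun _ hβ => mem_modelG₀_iff.1 hv _ (hD.comp_leftDeriv_mem hβ)

theorem IsMultiplicative.rightDeriv_mem {g : G} (h : G) {v : E} (hv : v ∈ D.modelG₀ g) :
    rightDeriv I h g v ∈ D.modelG₀ (g * h) :=
  mem_modelG₀_iff.2 fun _ hβ => mem_modelG₀_iff.1 hv _ (hD.comp_rightDeriv_mem hβ)

theorem IsMultiplicative.leftInvariant_mem {ξ : E →L[ℝ] ℝ} (hξ : ξ ∈ D.modelP₁ 1) (g : G) :
    ξ.comp (leftDeriv I g⁻¹ g) ∈ D.modelP₁ g :=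
  hD.comp_leftDeriv_mem (by rwa [inv_mul_cancel])

/-- The fibres of `G₀` have the same dimension. -/
theorem IsMultiplicative.finrank_modelG₀ [FiniteDimensional ℝ E] (g : G) :
    Module.finrank ℝ (D.modelG₀ g) = Module.finrank ℝ (D.modelG₀ 1) := by
  have inj : ∀ g h : G, Function.Injective (leftDeriv I g h) := fun g h =>
    Function.LeftInverse.injective (g := leftDeriv I g⁻¹ (g * h)) fun x =>
      DFunLike.congr_fun (leftDeriv_inv_comp I g h) x
  have le : ∀ g h : G, Module.finrank ℝ (D.modelG₀ h) ≤ Module.finrank ℝ (D.modelG₀ (g * h)) := by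
    intro g h
    rw [(Submodule.equivMapOfInjective (leftDeriv I g h : E →ₗ[ℝ] E) (inj g h) _).finrank_eq]
    refine Submodule.finrank_mono ?_
    rintro _ ⟨v, hv, rfl⟩
    exact hD.leftDeriv_mem g hv
  refine le_antisymm ?_ ?_
  · have := le g⁻¹ g
    rwa [inv_mul_cancel] at this
  · have := le g 1
    rwa [mul_one] at this

end Multiplicative

section Cocycle

variable {E : Type*} [NormedAddCommGroup E] [NormedSpace ℝ E]
  {H : Type*} [TopologicalSpace H] {I : ModelWithCorners ℝ E H}
  {G : Type u} [TopologicalSpace G] [ChartedSpace H G] [Group G] [LieGroup I ∞ G]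
  (D : DiracStructure I G)

/-- All vectors of the fibre of `D` over `n` lie in `G₀`. -/
def IsVerticalAt (n : G) : Prop :=
  ∀ v α, (v, α) ∈ D.modelFiber n → v ∈ D.modelG₀ n

open Classical in
/-- The function `η^L(X)`, where `(X, ξ^L)` is a (possibly discontinuous) section of `D`. -/
def cocycle (ξ η : E →L[ℝ] ℝ) (g : G) : ℝ :=
  if h : ∃ v, (v, ξ.comp (leftDeriv I g⁻¹ g)) ∈ D.modelFiber g then
    η (leftDeriv I g⁻¹ g h.choose) else 0

variable {D} (hD : D.IsMultiplicative)
include hD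

theorem IsMultiplicative.cocycle_eq {ξ η : E →L[ℝ] ℝ} (hη : η ∈ D.modelP₁ 1) {g : G} {v : E}
    (hv : (v, ξ.comp (leftDeriv I g⁻¹ g)) ∈ D.modelFiber g) :
    D.cocycle ξ η g = η (leftDeriv I g⁻¹ g v) := by
  have h : ∃ v, (v, ξ.comp (leftDeriv I g⁻¹ g)) ∈ D.modelFiber g := ⟨v, hv⟩
  rw [cocycle, dif_pos h]
  have hmem : h.choose - v ∈ D.modelG₀ g := by
    rw [mem_modelG₀]
    simpa using (D.modelFiber g).sub_mem h.choose_spec hv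
  have := mem_modelG₀_iff.1 hmem _ (hD.leftInvariant_mem hη g)
  simpa [sub_eq_zero] using this

/-- The coadjoint translates of elements of `𝔭₁` lie in `𝔭₁`. -/
theorem IsMultiplicative.coadjoint_mem {ξ : E →L[ℝ] ℝ} (hξ : ξ ∈ D.modelP₁ 1) (g : G) :
    (ξ.comp (leftDeriv I g⁻¹ g)).comp (rightDeriv I g 1) ∈ D.modelP₁ 1 :=
  hD.comp_rightDeriv_mem (by rw [one_mul]; exact hD.leftInvariant_mem hξ g)

omit hD in
theorem coadjoint_comp_leftDeriv (ξ : E →L[ℝ] ℝ) (h g : G) :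
    ((ξ.comp (leftDeriv I g⁻¹ g)).comp (rightDeriv I g 1)).comp (leftDeriv I h⁻¹ h) =
      (ξ.comp (leftDeriv I (h * g)⁻¹ (h * g))).comp (rightDeriv I g h) := by
  have h1 := leftDeriv_comp_rightDeriv I h⁻¹ h g
  rw [inv_mul_cancel] at h1
  have h2 := leftDeriv_comp I g⁻¹ h⁻¹ (h * g)
  rw [inv_mul_cancel_left] at h2
  rw [mul_inv_rev, ← h2]
  simp only [ContinuousLinearMap.comp_assoc]
  rw [h1]

theorem IsMultiplicative.cocycle_mul {ξ η : E →L[ℝ] ℝ} (hξ : ξ ∈ D.modelP₁ 1)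
    (hη : η ∈ D.modelP₁ 1) (h g : G) :
    D.cocycle ξ η (h * g) = D.cocycle ξ η g +
      D.cocycle ((ξ.comp (leftDeriv I g⁻¹ g)).comp (rightDeriv I g 1))
        ((η.comp (leftDeriv I g⁻¹ g)).comp (rightDeriv I g 1)) h := by
  obtain ⟨v, hv⟩ := mem_modelP₁.1 (hD.leftInvariant_mem hξ (h * g))
  obtain ⟨w, u, rfl, hw, hu⟩ := hD.exists_decomp hv
  have h2 := leftDeriv_comp I g⁻¹ h⁻¹ (h * g)
  rw [inv_mul_cancel_left] at h2
  have h3 : (leftDeriv I (h * g)⁻¹ (h * g)).comp (leftDeriv I h g) = leftDeriv I g⁻¹ g := by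
    rw [leftDeriv_comp]; simp
  rw [hD.cocycle_eq hη hv]
  rw [ContinuousLinearMap.comp_assoc, h3] at hu
  rw [← coadjoint_comp_leftDeriv] at hw
  rw [hD.cocycle_eq hη hu, hD.cocycle_eq (hD.coadjoint_mem hη g) hw, map_add, map_add, add_comm]
  congr 1
  · exact congrArg η (DFunLike.congr_fun h3 u)
  · exact (DFunLike.congr_fun (coadjoint_comp_leftDeriv η h g) w).symm

theorem IsMultiplicative.cocycle_one {ξ η : E →L[ℝ] ℝ} (hξ : ξ ∈ D.modelP₁ 1)
    (hη : η ∈ D.modelP₁ 1) : D.cocycle ξ η 1 = 0 := by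
  have := hD.cocycle_mul hξ hη 1 1
  simpa [leftDeriv_one, rightDeriv_one] using this

theorem IsMultiplicative.isVerticalAt_iff {n : G} :
    D.IsVerticalAt n ↔ ∀ ξ ∈ D.modelP₁ 1, ∀ η ∈ D.modelP₁ 1, D.cocycle ξ η n = 0 := by
  constructor
  · intro h ξ hξ η hη
    obtain ⟨v, hv⟩ := mem_modelP₁.1 (hD.leftInvariant_mem hξ n)
    rw [hD.cocycle_eq hη hv]
    exact mem_modelG₀_iff.1 (h v _ hv) _ (hD.leftInvariant_mem hη n)
  · intro h v α hv
    have key : ∀ β ∈ D.modelP₁ n, β.comp (leftDeriv I n 1) ∈ D.modelP₁ 1 ∧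
        (β.comp (leftDeriv I n 1)).comp (leftDeriv I n⁻¹ n) = β := by
      intro β hβ
      refine ⟨hD.comp_leftDeriv_mem (by rwa [mul_one]), ?_⟩
      have := leftDeriv_comp_inv I n 1
      rw [mul_one] at this
      rw [ContinuousLinearMap.comp_assoc, this, ContinuousLinearMap.comp_id]
    refine mem_modelG₀_iff.2 fun β hβ => ?_
    obtain ⟨hα1, hα2⟩ := key α (mem_modelP₁.2 ⟨v, hv⟩)
    obtain ⟨hβ1, hβ2⟩ := key β hβ
    have := h _ hα1 _ hβ1
    rw [hD.cocycle_eq (v := v) hβ1 (by rwa [hα2])] at this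
    exact (DFunLike.congr_fun hβ2 v).symm.trans this

theorem IsMultiplicative.isVerticalAt_one : D.IsVerticalAt (1 : G) :=
  hD.isVerticalAt_iff.2 fun _ hξ _ hη => hD.cocycle_one hξ hη

theorem IsMultiplicative.mem_modelFiber_left {n : G} (hn : D.IsVerticalAt n) {g : G} {v : E}
    {α : E →L[ℝ] ℝ} (hv : (v, α) ∈ D.modelFiber (n * g)) :
    (leftDeriv I n⁻¹ (n * g) v, α.comp (leftDeriv I n g)) ∈ D.modelFiber g := by
  obtain ⟨w, u, rfl, hw, hu⟩ := hD.exists_decomp hv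
  have h1 := hD.leftDeriv_mem n⁻¹ (hD.rightDeriv_mem g (hn _ _ hw))
  rw [inv_mul_cancel_left] at h1
  have h2 := (D.modelFiber g).add_mem (mem_modelG₀.1 h1) hu
  have h3 : leftDeriv I n⁻¹ (n * g) (leftDeriv I n g u) = u :=
    DFunLike.congr_fun (leftDeriv_inv_comp I n g) u
  rw [map_add, h3]
  simpa using h2

theorem IsMultiplicative.mem_modelFiber_right {n : G} (hn : D.IsVerticalAt n) {g : G} {v : E}
    {α : E →L[ℝ] ℝ} (hv : (v, α) ∈ D.modelFiber (g * n)) :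
    (rightDeriv I n⁻¹ (g * n) v, α.comp (rightDeriv I n g)) ∈ D.modelFiber g := by
  obtain ⟨w, u, rfl, hw, hu⟩ := hD.exists_decomp hv
  have h1 := hD.rightDeriv_mem n⁻¹ (hD.leftDeriv_mem g (hn _ _ hu))
  rw [mul_inv_cancel_right] at h1
  have h2 := (D.modelFiber g).add_mem hw (mem_modelG₀.1 h1)
  have h3 : rightDeriv I n⁻¹ (g * n) (rightDeriv I n g w) = w :=
    DFunLike.congr_fun (rightDeriv_inv_comp I n g) w
  rw [map_add, h3]
  simpa using h2

theorem IsMultiplicative.isVerticalAt_of_left {n : G}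
    (h : ∀ v α, (v, α) ∈ D.modelFiber n →
      (leftDeriv I n⁻¹ n v, α.comp (leftDeriv I n 1)) ∈ D.modelFiber 1) :
    D.IsVerticalAt n := by
  intro v α hv
  have h1 := hD.leftDeriv_mem n (hD.isVerticalAt_one _ _ (h v α hv))
  have h2 := leftDeriv_comp_inv I n 1
  rw [mul_one] at h1 h2
  convert h1
  exact (DFunLike.congr_fun h2 v).symm

theorem IsMultiplicative.isVerticalAt_of_right {n : G}
    (h : ∀ v α, (v, α) ∈ D.modelFiber n →
      (rightDeriv I n⁻¹ n v, α.comp (rightDeriv I n 1)) ∈ D.modelFiber 1) :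
    D.IsVerticalAt n := by
  intro v α hv
  have h1 := hD.rightDeriv_mem n (hD.isVerticalAt_one _ _ (h v α hv))
  have h2 := rightDeriv_comp_inv I n 1
  rw [one_mul] at h1 h2
  convert h1
  exact (DFunLike.congr_fun h2 v).symm

end Cocycle

end DiracStructure

section Forms

open Bundle Filter Topology

variable {E : Type*} [NormedAddCommGroup E] [NormedSpace ℝ E]
  {H : Type*} [TopologicalSpace H] {I : ModelWithCorners ℝ E H}
  {M : Type*} [TopologicalSpace M] [ChartedSpace H M] [IsManifold I ∞ M]
  {E' : Type*} [NormedAddCommGroup E'] [NormedSpace ℝ E']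
  {H' : Type*} [TopologicalSpace H'] {I' : ModelWithCorners ℝ E' H'}
  {M' : Type*} [TopologicalSpace M'] [ChartedSpace H' M'] [IsManifold I' ∞ M']

/-- The composition of a form along `b` with a family of linear maps over `b` is smooth. -/
theorem ContMDiffWithinAt.form_comp {b : M → M'} {β : ∀ m, TangentSpace I' (b m) →L[ℝ] ℝ}
    {φ : ∀ m, TangentSpace I m →L[ℝ] TangentSpace I' (b m)} {s : Set M} {m₀ : M}
    (hm₀ : m₀ ∈ s)
    (hβ : ContMDiffWithinAt I (I'.prod 𝓘(ℝ, E' →L[ℝ] ℝ)) ∞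
      (fun m => TotalSpace.mk' (E' →L[ℝ] ℝ)
        (E := fun x : M' => TangentSpace I' x →L[ℝ] Bundle.Trivial M' ℝ x) (b m) (β m)) s m₀)
    (hφ : ContMDiffWithinAt I 𝓘(ℝ, E →L[ℝ] E') ∞ (inTangentCoordinates I I' id b φ m₀) s m₀) :
    ContMDiffWithinAt I (I.prod 𝓘(ℝ, E →L[ℝ] ℝ)) ∞
      (fun m => TotalSpace.mk' (E →L[ℝ] ℝ)
        (E := fun x : M => TangentSpace I x →L[ℝ] Bundle.Trivial M ℝ x) m ((β m).comp (φ m)))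
      s m₀ := by
  rw [contMDiffWithinAt_hom_bundle] at hβ ⊢
  refine ⟨contMDiffWithinAt_id, ?_⟩
  refine (hβ.2.clm_comp hφ).congr_of_eventuallyEq_of_mem ?_ hm₀
  have A : ∀ᶠ m in 𝓝[s] m₀, b m ∈ (trivializationAt E' (TangentSpace I') (b m₀)).baseSet :=
    hβ.1.continuousWithinAt ((trivializationAt E' (TangentSpace I') (b m₀)).open_baseSet.mem_nhds
      (FiberBundle.mem_baseSet_trivializationAt' (b m₀)))
  filter_upwards [A] with m hm
  ext v
  have key := (trivializationAt E' (TangentSpace I') (b m₀)).symmL_continuousLinearMapAt (R := ℝ) hm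
    (φ m ((trivializationAt E (TangentSpace I) m₀).symmL ℝ m v))
  have h1 : ∀ r : ℝ, (trivializationAt ℝ (Bundle.Trivial M ℝ) m₀).continuousLinearMapAt ℝ m r = r :=
    DFunLike.congr_fun (Bundle.Trivial.continuousLinearMapAt_trivialization ℝ M ℝ m)
  have h2 : ∀ r : ℝ,
      (trivializationAt ℝ (Bundle.Trivial M' ℝ) (b m₀)).continuousLinearMapAt ℝ (b m) r = r :=
    DFunLike.congr_fun (Bundle.Trivial.continuousLinearMapAt_trivialization ℝ M' ℝ (b m))
  exact (h1 _).trans ((congrArg (β m) key).symm.trans (h2 _).symm)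

theorem IsSmoothFormOn.pullback {φ : M → M'} (hφ : ContMDiff I I' ∞ φ) {U : Set M'}
    {α : ∀ m : M', CotangentFiber I' m} (hα : IsSmoothFormOn U α) :
    IsSmoothFormOn (φ ⁻¹' U) (fun m => (α (φ m)).comp (mfderiv I I' φ m)) := by
  intro m hm
  refine ContMDiffWithinAt.form_comp hm ?_ ?_
  · exact (hα (φ m) hm).comp m (hφ m).contMDiffWithinAt (fun _ h => h)
  · exact (hφ.contMDiffAt.mfderiv_const (m := ∞) (by simp)).contMDiffWithinAt

end Forms

section LeftInvariant

open Bundle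

variable {E : Type*} [NormedAddCommGroup E] [NormedSpace ℝ E]
  {H : Type*} [TopologicalSpace H] {I : ModelWithCorners ℝ E H}
  {G : Type u} [TopologicalSpace G] [ChartedSpace H G] [Group G] [LieGroup I ∞ G]

theorem isSmoothFormOn_leftInvariantForm (ξ : CotangentFiber I (1 : G)) (U : Set G) :
    IsSmoothFormOn U (leftInvariantForm ξ) := by
  intro g hg
  have hmul : ContMDiff (I.prod I) I ∞ (Function.uncurry fun g h : G => g⁻¹ * h) :=
    (contMDiff_fst.inv).mul contMDiff_snd
  have hφ := ContMDiffAt.mfderiv (I := I) (I' := I) (J := I) (m := ∞) (x₀ := g)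
    (fun g h : G => g⁻¹ * h) id (hmul _) contMDiffAt_id (by simp)
  refine ContMDiffWithinAt.form_comp (b := fun g : G => g⁻¹ * g)
    (β := fun _ => (ξ : E →L[ℝ] ℝ)) hg ?_ hφ.contMDiffWithinAt
  have : (fun m : G => TotalSpace.mk' (E →L[ℝ] ℝ)
      (E := fun x : G => TangentSpace I x →L[ℝ] Bundle.Trivial G ℝ x) (m⁻¹ * m)
        (ξ : E →L[ℝ] ℝ)) = fun _ => TotalSpace.mk' (E →L[ℝ] ℝ)
      (E := fun x : G => TangentSpace I x →L[ℝ] Bundle.Trivial G ℝ x) 1 ξ := by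
    funext m
    generalize h : m⁻¹ * m = x
    rw [inv_mul_cancel] at h
    subst h
    rfl
  rw [this]
  exact contMDiffWithinAt_const

end LeftInvariant

namespace DiracStructure

section Preserved

variable {E : Type*} [NormedAddCommGroup E] [NormedSpace ℝ E]
  {H : Type*} [TopologicalSpace H] {I : ModelWithCorners ℝ E H}
  {M : Type u} [TopologicalSpace M] [ChartedSpace H M] [IsManifold I ∞ M]
  {D : DiracStructure I M}

theorem exists_isSection {m : M} {a : PontryaginFiber I m} (ha : a ∈ D.fiber m) :
    ∃ U X α, m ∈ U ∧ D.IsSection U X α ∧ X m = a.1 ∧ α m = a.2 := by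
  obtain ⟨U, hU, hm, k, X, α, hX, hα, hspan⟩ := D.exists_local_frame m
  rw [← (hspan m hm).2, Submodule.mem_span_range_iff_exists_fun] at ha
  obtain ⟨c, rfl⟩ := ha
  refine ⟨U, fun p => ∑ i, c i • X i p, fun p => ∑ i, c i • α i p, hm, ⟨hU, ?_, ?_, ?_⟩, ?_, ?_⟩
  · exact ContMDiffOn.sum_section fun i _ => (hX i).const_smul_section
  · exact ContMDiffOn.sum_section (V := fun m : M => TangentSpace I m →L[ℝ] Bundle.Trivial M ℝ m)
      fun i _ => (hα i).const_smul_section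
  · intro p hp
    rw [← (hspan p hp).2, Submodule.mem_span_range_iff_exists_fun]
    refine ⟨c, ?_⟩
    ext1 <;> simp [Prod.fst_sum, Prod.snd_sum]
  · simp [Prod.fst_sum]
  · simp [Prod.snd_sum]

theorem IsPreservedBy.mem {φ : M → M} (h : D.IsPreservedBy φ) {m : M} {v : E} {α : E →L[ℝ] ℝ}
    (hv : (v, α) ∈ D.modelFiber (φ m)) :
    ((modelMFDeriv I I φ m).inverse v, α.comp (modelMFDeriv I I φ m)) ∈ D.modelFiber m := by
  obtain ⟨U, X, β, hm, hsec, hX, hβ⟩ := exists_isSection hv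
  have key : ((modelMFDeriv I I φ m).inverse (X (φ m)),
      (show E →L[ℝ] ℝ from β (φ m)).comp (modelMFDeriv I I φ m)) ∈ D.modelFiber m :=
    (h U X β hsec).2.2.2 m hm
  have hX' : (X (φ m) : E) = v := hX
  have hβ' : (β (φ m) : E →L[ℝ] ℝ) = α := hβ
  rw [← hX', ← hβ']
  exact key

theorem isPreservedBy_of_mem [CompleteSpace E] {φ : M → M} (hφ : ContMDiff I I ∞ φ)
    (hinv : ∀ m, (modelMFDeriv I I φ m).IsInvertible)
    (h : ∀ (m : M) (v : E) (α : E →L[ℝ] ℝ), (v, α) ∈ D.modelFiber (φ m) →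
      ((modelMFDeriv I I φ m).inverse v, α.comp (modelMFDeriv I I φ m)) ∈ D.modelFiber m) :
    D.IsPreservedBy φ := by
  rintro U X α ⟨hU, hX, hα, hmem⟩
  refine ⟨hU.preimage hφ.continuous, ?_, hα.pullback hφ, fun m hm => h m _ _ (hmem _ hm)⟩
  exact ContMDiffOn.mpullback_vectorField_preimage hX hφ (fun m _ => hinv m) (by simp)

end Preserved

section Translations

variable {E : Type*} [NormedAddCommGroup E] [NormedSpace ℝ E]
  {H : Type*} [TopologicalSpace H] {I : ModelWithCorners ℝ E H}
  {G : Type u} [TopologicalSpace G] [ChartedSpace H G] [Group G] [LieGroup I ∞ G]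
  {D : DiracStructure I G}

theorem inverse_leftDeriv (g h : G) :
    (leftDeriv I g h).inverse = leftDeriv I g⁻¹ (g * h) :=
  ContinuousLinearMap.inverse_eq (leftDeriv_comp_inv I g h) (leftDeriv_inv_comp I g h)

theorem inverse_rightDeriv (h g : G) :
    (rightDeriv I h g).inverse = rightDeriv I h⁻¹ (g * h) :=
  ContinuousLinearMap.inverse_eq (rightDeriv_comp_inv I h g) (rightDeriv_inv_comp I h g)

theorem isInvertible_leftDeriv (g h : G) : (leftDeriv I g h).IsInvertible :=
  ContinuousLinearMap.IsInvertible.of_inverse (leftDeriv_comp_inv I g h) (leftDeriv_inv_comp I g h)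

theorem isInvertible_rightDeriv (h g : G) : (rightDeriv I h g).IsInvertible :=
  ContinuousLinearMap.IsInvertible.of_inverse (rightDeriv_comp_inv I h g)
    (rightDeriv_inv_comp I h g)

variable [CompleteSpace E] (hD : D.IsMultiplicative)
include hD

/-- `D` is invariant under the left translation by `n` iff it is contained in `G₀ ⊕ T*` at `n`. -/
theorem IsMultiplicative.isPreservedBy_mul_left_iff (n : G) :
    D.IsPreservedBy (fun g => n * g) ↔ D.IsVerticalAt n := by
  constructor
  · intro h
    refine hD.isVerticalAt_of_left fun v α hv => ?_
    have hv' : (v, α) ∈ D.modelFiber (n * 1) := by rwa [mul_one]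
    have h1 := h.mem hv'
    have h2 := inverse_leftDeriv (I := I) n 1
    rw [mul_one] at h2
    rw [← h2]
    exact h1
  · intro h
    refine isPreservedBy_of_mem contMDiff_mul_left (isInvertible_leftDeriv n) fun g v α hv => ?_
    have h1 := hD.mem_modelFiber_left h hv
    rw [← inverse_leftDeriv] at h1
    exact h1

/-- `D` is invariant under the right translation by `n` iff it is contained in `G₀ ⊕ T*` at `n`. -/
theorem IsMultiplicative.isPreservedBy_mul_right_iff (n : G) :
    D.IsPreservedBy (fun g => g * n) ↔ D.IsVerticalAt n := by
  constructor
  · intro h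
    refine hD.isVerticalAt_of_right fun v α hv => ?_
    have hv' : (v, α) ∈ D.modelFiber (1 * n) := by rwa [one_mul]
    have h1 := h.mem hv'
    have h2 := inverse_rightDeriv (I := I) n 1
    rw [one_mul] at h2
    rw [← h2]
    exact h1
  · intro h
    refine isPreservedBy_of_mem contMDiff_mul_right (isInvertible_rightDeriv n) fun g v α hv => ?_
    have h1 := hD.mem_modelFiber_right h hv
    rw [← inverse_rightDeriv] at h1
    exact h1

end Translations

end DiracStructure

/-- The form `α` at `m`, as a continuous linear form on the model space. -/
def CotangentFiber.toModel {E : Type*} [NormedAddCommGroup E] [NormedSpace ℝ E]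
    {H : Type*} [TopologicalSpace H] {I : ModelWithCorners ℝ E H}
    {M : Type*} [TopologicalSpace M] [ChartedSpace H M] {m : M} (α : CotangentFiber I m) :
    E →L[ℝ] ℝ := α

section Coefficients

/-- If smooth maps `A i` to a finite-dimensional space take values in a subspace `p` and span it at
one point, then near that point a vector of `p` is a combination of them with smooth
coefficients. -/
theorem exists_contMDiffOn_sum_smul_eq {E : Type*} [NormedAddCommGroup E] [NormedSpace ℝ E]
    {H : Type*} [TopologicalSpace H] {I : ModelWithCorners ℝ E H}
    {M : Type*} [TopologicalSpace M] [ChartedSpace H M]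
    {V : Type*} [NormedAddCommGroup V] [NormedSpace ℝ V] [FiniteDimensional ℝ V]
    (p : Submodule ℝ V) {U : Set M} (hU : IsOpen U) {m₀ : M} (hm₀ : m₀ ∈ U) {k : ℕ}
    {A : Fin k → M → V} (hA : ∀ i, ContMDiffOn I 𝓘(ℝ, V) ∞ (A i) U)
    (hAmem : ∀ i, ∀ m ∈ U, A i m ∈ p)
    (hspan : ∀ ζ ∈ p, ∃ c : Fin k → ℝ, ∑ i, c i • A i m₀ = ζ) {ξ : V} (hξ : ξ ∈ p) :
    ∃ W ⊆ U, IsOpen W ∧ m₀ ∈ W ∧ ∃ r : Fin k → M → ℝ,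
      (∀ i, ContMDiffOn I 𝓘(ℝ, ℝ) ∞ (r i) W) ∧ ∀ m ∈ W, ∑ i, r i m • A i m = ξ := by
  obtain ⟨B, hB⟩ : ∃ B : p →ₗ[ℝ] (Fin k → ℝ), ∀ ζ : p, ∑ i, B ζ i • A i m₀ = ζ := by
    let S : (Fin k → ℝ) →ₗ[ℝ] p :=
      Fintype.linearCombination ℝ fun i => (⟨A i m₀, hAmem i m₀ hm₀⟩ : p)
    have hS : LinearMap.range S = ⊤ := by
      rw [LinearMap.range_eq_top]
      rintro ⟨ζ, hζ⟩
      obtain ⟨c, hc⟩ := hspan ζ hζ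
      refine ⟨c, Subtype.ext ?_⟩
      simpa [S, Fintype.linearCombination_apply] using hc
    obtain ⟨B, hB⟩ := S.exists_rightInverse_of_surjective hS
    refine ⟨B, fun ζ => ?_⟩
    have := congrArg Subtype.val (LinearMap.congr_fun hB ζ)
    simpa [S, Fintype.linearCombination_apply] using this
  obtain ⟨Q, hQ⟩ := p.subtype.exists_leftInverse_of_injective (by simp)
  have hQ' : ∀ ζ (hζ : ζ ∈ p), Q ζ = ⟨ζ, hζ⟩ := fun ζ hζ => LinearMap.congr_fun hQ ⟨ζ, hζ⟩
  let c : Fin k → (p →L[ℝ] ℝ) := fun i =>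
    LinearMap.toContinuousLinearMap ((LinearMap.proj i).comp B)
  let P : M → (p →L[ℝ] p) := fun m =>
    ∑ i, ContinuousLinearMap.smulRightL ℝ p p (c i) (LinearMap.toContinuousLinearMap Q (A i m))
  have hPapply : ∀ m ζ, P m ζ = Q (∑ i, B ζ i • A i m) := by
    intro m ζ
    simp [P, c]
  have hP : ContMDiffOn I 𝓘(ℝ, p →L[ℝ] p) ∞ P U := by
    refine contMDiffOn_finsetSum fun i _ => ?_
    exact (((ContinuousLinearMap.smulRightL ℝ p p (c i)).comp
      (LinearMap.toContinuousLinearMap Q)).contMDiff).comp_contMDiffOn (hA i)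
  have hP1 : P m₀ = 1 := by
    ext ζ : 1
    rw [hPapply, hB, hQ' _ ζ.2]
    rfl
  have : CompleteSpace p := FiniteDimensional.complete ℝ p
  let f : Fin k → ((p →L[ℝ] p) →L[ℝ] ℝ) := fun i =>
    (c i).comp (ContinuousLinearMap.apply ℝ p (⟨ξ, hξ⟩ : p))
  refine ⟨U ∩ P ⁻¹' {T | IsUnit T}, Set.inter_subset_left,
    hP.continuousOn.isOpen_inter_preimage hU (by exact Units.isOpen (R := p →L[ℝ] p)),
    ⟨hm₀, by simp [hP1]⟩,
    fun i m => f i (Ring.inverse (P m)), ?_, ?_⟩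
  · intro i m hm
    obtain ⟨T, hT⟩ := hm.2
    have h1 : ContDiffAt ℝ ∞ (Ring.inverse : (p →L[ℝ] p) → (p →L[ℝ] p)) (P m) := by
      rw [← hT]
      exact contDiffAt_ringInverse ℝ (R := p →L[ℝ] p) T
    have h2 := (((f i).contDiff.contDiffAt (x := Ring.inverse (P m))).comp (P m) h1).contMDiffAt
    exact h2.comp_contMDiffWithinAt m ((hP m hm.1).mono Set.inter_subset_left)
  · intro m hm
    set ζ : p := Ring.inverse (P m) ⟨ξ, hξ⟩ with hζ
    have hmem : ∑ i, B ζ i • A i m ∈ p :=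
      Submodule.sum_mem _ fun i _ => Submodule.smul_mem _ _ (hAmem i m hm.1)
    have h2 : P m ζ = ⟨ξ, hξ⟩ :=
      DFunLike.congr_fun (Ring.mul_inverse_cancel (P m) hm.2) (⟨ξ, hξ⟩ : p)
    rw [hPapply, hQ' _ hmem] at h2
    exact congrArg Subtype.val h2

end Coefficients

section Evaluation

open Bundle

variable {E : Type*} [NormedAddCommGroup E] [NormedSpace ℝ E]
  {H : Type*} [TopologicalSpace H] {I : ModelWithCorners ℝ E H}

theorem IsSmoothFormOn.apply {M : Type*} [TopologicalSpace M] [ChartedSpace H M]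
    [IsManifold I ∞ M] {U : Set M} {α : ∀ m : M, CotangentFiber I m}
    {X : ∀ m : M, TangentSpace I m} (hα : IsSmoothFormOn U α) (hX : IsSmoothFieldOn U X) :
    ContMDiffOn I 𝓘(ℝ, ℝ) ∞ (fun m => α m (X m)) U := by
  intro m hm
  have := ContMDiffWithinAt.clm_bundle_apply (E₂ := Bundle.Trivial M ℝ) (hα m hm) (hX m hm)
  exact (contMDiffWithinAt_totalSpace.1 this).2

variable {G : Type u} [TopologicalSpace G] [ChartedSpace H G] [Group G] [LieGroup I ∞ G]

theorem isSmoothFieldOn_leftDeriv (x : E) (U : Set G) :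
    IsSmoothFieldOn (I := I) U (fun g => leftDeriv I g 1 x) := by
  intro g _
  have hφ := ContMDiffAt.mfderiv (I := I) (I' := I) (J := I) (m := ∞) (x₀ := g)
    (fun g h : G => g * h) (fun _ => 1) (contMDiff_mul I ∞ _) contMDiffAt_const (by simp)
  have := hφ.clm_apply_of_inCoordinates (v := fun _ => x)
    (F₁ := E) (E₁ := TangentSpace I (M := G)) (F₂ := E) (E₂ := TangentSpace I (M := G))
    (M := G) (IM := I) (IB₁ := I) (IB₂ := I) (B₁ := G) (B₂ := G)
    (b₁ := fun _ : G => (1 : G)) (b₂ := fun g : G => g * 1)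
    contMDiffAt_const (contMDiff_mul_right (I := I) (n := ∞) g)
  refine ContMDiffAt.contMDiffWithinAt ?_
  convert this using 2 with h
  have aux : ∀ (y : G) (w : E), y = h → TotalSpace.mk' E (E := TangentSpace I (M := G)) h w =
      TotalSpace.mk' E y w := by
    rintro y w rfl
    rfl
  exact aux (h * 1) _ (mul_one h)

/-- A smooth form is smooth in the left trivialization. -/
theorem IsSmoothFormOn.comp_leftDeriv [FiniteDimensional ℝ E] {U : Set G}
    {α : ∀ g : G, CotangentFiber I g} (hα : IsSmoothFormOn U α) :
    ContMDiffOn I 𝓘(ℝ, E →L[ℝ] ℝ) ∞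
      (fun g => (α g).toModel.comp (leftDeriv I g 1)) U := by
  let b := Module.finBasis ℝ E
  have key : (fun g => (α g).toModel.comp (leftDeriv I g 1)) = fun g =>
      ∑ j, (α g).toModel (leftDeriv I g 1 (b j)) •
        LinearMap.toContinuousLinearMap (b.coord j) := by
    funext g
    ext x
    have h := congrArg (fun y => (α g).toModel (leftDeriv I g 1 y)) (b.sum_repr x)
    simp only [map_sum, map_smul, smul_eq_mul] at h
    rw [ContinuousLinearMap.comp_apply, ← h]
    simp [mul_comm]
  rw [key]
  refine contMDiffOn_finsetSum fun j _ => ?_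
  have h : ContMDiffOn I 𝓘(ℝ, ℝ) ∞ (fun g => (α g).toModel (leftDeriv I g 1 (b j))) U :=
    hα.apply (isSmoothFieldOn_leftDeriv (b j) U)
  exact h.smul contMDiffOn_const

end Evaluation

namespace DiracStructure

section Bracket

variable {E : Type*} [NormedAddCommGroup E] [NormedSpace ℝ E]
  {H : Type*} [TopologicalSpace H] {I : ModelWithCorners ℝ E H}
  {G : Type u} [TopologicalSpace G] [ChartedSpace H G] [Group G] [LieGroup I ∞ G]

/-- The bracket of `𝔭₁`, on the dual of the model space. -/
def modelBracket (D : DiracStructure I G) (ξ η : E →L[ℝ] ℝ) : E →L[ℝ] ℝ := D.dualBracket ξ η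

end Bracket

section Lift

variable {E : Type*} [NormedAddCommGroup E] [NormedSpace ℝ E] [FiniteDimensional ℝ E]
  {H : Type*} [TopologicalSpace H] {I : ModelWithCorners ℝ E H}
  {G : Type u} [TopologicalSpace G] [ChartedSpace H G] [Group G] [LieGroup I ∞ G]
  {D : DiracStructure I G} (hD : D.IsMultiplicative)
include hD

theorem IsMultiplicative.exists_isLift {ξ : E →L[ℝ] ℝ} (hξ : ξ ∈ D.modelP₁ 1) :
    ∃ X, D.IsLift (I := I) (G := G) ξ X := by
  obtain ⟨U, hU, h1U, k, X, α, hX, hα, hspan⟩ := D.exists_local_frame 1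
  have hAmem : ∀ i, ∀ g ∈ U, (α i g).toModel.comp (leftDeriv I g 1) ∈ D.modelP₁ 1 := by
    intro i g hg
    refine hD.comp_leftDeriv_mem (mem_modelP₁.2 ⟨X i g, ?_⟩)
    have : ((X i g, α i g) : PontryaginFiber I g) ∈ D.fiber g :=
      (hspan g hg).2 ▸ Submodule.subset_span ⟨i, rfl⟩
    rw [mul_one]
    exact this
  have hA1 : ∀ ζ ∈ D.modelP₁ 1, ∃ c : Fin k → ℝ,
      ∑ i, c i • (α i 1).toModel.comp (leftDeriv I (1 : G) 1) = ζ := by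
    intro ζ hζ
    obtain ⟨v, hv⟩ := mem_modelP₁.1 hζ
    have hv' : ((v, ζ) : PontryaginFiber I (1 : G)) ∈ D.fiber 1 := hv
    rw [← (hspan 1 h1U).2, Submodule.mem_span_range_iff_exists_fun] at hv'
    obtain ⟨c, hc⟩ := hv'
    refine ⟨c, ?_⟩
    have h2 := congrArg Prod.snd hc
    rw [Prod.snd_sum] at h2
    simp only [leftDeriv_one, ContinuousLinearMap.comp_id]
    exact h2
  obtain ⟨W, hWU, hW, h1W, r, hr, hsum⟩ := exists_contMDiffOn_sum_smul_eq (I := I)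
    (D.modelP₁ 1) hU h1U
    (fun i => (hα i).comp_leftDeriv) hAmem hA1 hξ
  refine ⟨fun g => ∑ i, r i g • X i g, W, h1W, hW, ?_, isSmoothFormOn_leftInvariantForm ξ W, ?_⟩
  · exact ContMDiffOn.sum_section fun i _ => (hr i).smul_section ((hX i).mono hWU)
  · intro g hg
    have h2 : ∑ i, r i g • (α i g).toModel = ξ.comp (leftDeriv I g⁻¹ g) := by
      have h3 := leftDeriv_comp_inv I g 1
      rw [mul_one] at h3
      rw [← hsum g hg]
      ext x
      have h4 : leftDeriv I g 1 (leftDeriv I g⁻¹ g x) = x := DFunLike.congr_fun h3 x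
      simp [h4]
    have h3 : ∑ i, r i g • ((X i g, α i g) : PontryaginFiber I g) ∈ D.fiber g := by
      refine Submodule.sum_mem _ fun i _ => Submodule.smul_mem _ _ ?_
      exact (hspan g (hWU hg)).2 ▸ Submodule.subset_span ⟨i, rfl⟩
    convert h3 using 1
    refine Prod.ext ?_ ?_
    · simp [Prod.fst_sum]
    · rw [Prod.snd_sum]
      exact h2.symm

omit [FiniteDimensional ℝ E] in
theorem IsMultiplicative.cocycle_eventuallyEq {ξ η : E →L[ℝ] ℝ} (hη : η ∈ D.modelP₁ 1)
    {X : ∀ g : G, TangentSpace I g} (hX : D.IsLift ξ X) :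
    (fun g => leftInvariantForm (I := I) (G := G) η g (X g)) =ᶠ[nhds 1] D.cocycle ξ η := by
  obtain ⟨U, h1U, hU, -, -, hmem⟩ := hX
  filter_upwards [hU.mem_nhds h1U] with g hg
  exact (hD.cocycle_eq hη (v := X g) (hmem g hg)).symm

theorem IsMultiplicative.hasMFDerivAt_lift {ξ η : E →L[ℝ] ℝ} (hξ : ξ ∈ D.modelP₁ 1)
    (hη : η ∈ D.modelP₁ 1) {X : ∀ g : G, TangentSpace I g} (hX : D.IsLift ξ X) :
    HasMFDerivAt I 𝓘(ℝ, ℝ) (fun g : G => leftInvariantForm (I := I) η g (X g)) 1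
      (D.dualBracket ξ η) := by
  have h := hD.exists_isLift hξ
  have heq := (hD.cocycle_eventuallyEq hη hX).trans
    (hD.cocycle_eventuallyEq hη h.choose_spec).symm
  obtain ⟨U, h1U, hU, hs, -, -⟩ := h.choose_spec
  have hd : MDifferentiableAt I 𝓘(ℝ, ℝ)
      (fun g : G => leftInvariantForm (I := I) η g (h.choose g)) 1 :=
    (((isSmoothFormOn_leftInvariantForm η U).apply hs).contMDiffAt
      (hU.mem_nhds h1U)).mdifferentiableAt (by simp)
  have := hd.hasMFDerivAt.congr_of_eventuallyEq heq
  have hb : D.dualBracket ξ η = mfderiv I 𝓘(ℝ, ℝ)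
      (fun g : G => leftInvariantForm (I := I) η g (h.choose g)) 1 := dif_pos h
  rw [hb]
  exact this

theorem IsMultiplicative.hasMFDerivAt_cocycle_one {ξ η : E →L[ℝ] ℝ} (hξ : ξ ∈ D.modelP₁ 1)
    (hη : η ∈ D.modelP₁ 1) :
    HasMFDerivAt I 𝓘(ℝ, ℝ) (D.cocycle ξ η) 1 (D.dualBracket ξ η) := by
  obtain ⟨X, hX⟩ := hD.exists_isLift hξ
  exact (hD.hasMFDerivAt_lift hξ hη hX).congr_of_eventuallyEq
    (hD.cocycle_eventuallyEq hη hX).symm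

/-- The derivative of the cocycle at `g`, by right translation to the neutral element. -/
theorem IsMultiplicative.hasMFDerivAt_cocycle {ξ η : E →L[ℝ] ℝ} (hξ : ξ ∈ D.modelP₁ 1)
    (hη : η ∈ D.modelP₁ 1) (g : G) :
    HasMFDerivAt I 𝓘(ℝ, ℝ) (D.cocycle ξ η) g
      ((D.modelBracket ((ξ.comp (leftDeriv I g⁻¹ g)).comp (rightDeriv I g 1))
        ((η.comp (leftDeriv I g⁻¹ g)).comp (rightDeriv I g 1))).comp (rightDeriv I g⁻¹ g) :
        E →L[ℝ] ℝ) := by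
  set ξ' := (ξ.comp (leftDeriv I g⁻¹ g)).comp (rightDeriv I g 1)
  set η' := (η.comp (leftDeriv I g⁻¹ g)).comp (rightDeriv I g 1)
  have key : D.cocycle ξ η = fun p => D.cocycle ξ η g + D.cocycle ξ' η' (p * g⁻¹) := by
    funext p
    have := hD.cocycle_mul hξ hη (p * g⁻¹) g
    rwa [inv_mul_cancel_right] at this
  have h1 : ∀ x : G, x = 1 → HasMFDerivAt I 𝓘(ℝ, ℝ) (D.cocycle ξ' η') x
      (D.modelBracket ξ' η') := by
    rintro _ rfl
    exact hD.hasMFDerivAt_cocycle_one (hD.coadjoint_mem hξ g) (hD.coadjoint_mem hη g)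
  have h2 := (h1 (g * g⁻¹) (mul_inv_cancel g)).comp g
    (mdifferentiableAt_mul_right' I g⁻¹ g).hasMFDerivAt
  have h3 := (hasMFDerivAt_const (I := I) (I' := 𝓘(ℝ, ℝ)) (D.cocycle ξ η g) g).add h2
  rw [key]
  exact h3.congr_mfderiv (zero_add (_ : E →L[ℝ] ℝ))

end Lift

end DiracStructure

section Curves

open Bundle Filter Topology

variable {E : Type*} [NormedAddCommGroup E] [NormedSpace ℝ E]
  {H : Type*} [TopologicalSpace H] {I : ModelWithCorners ℝ E H} [I.Boundaryless]
  {M : Type*} [TopologicalSpace M] [ChartedSpace H M] [IsManifold I ∞ M]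

/-- A function on a connected manifold whose derivative vanishes is constant. -/
theorem eq_of_hasMFDerivAt_eq_zero [ConnectedSpace M] {f : M → ℝ}
    (hf : ∀ m, HasMFDerivAt I 𝓘(ℝ, ℝ) f m (0 : E →L[ℝ] ℝ)) (x y : M) : f x = f y := by
  refine IsLocallyConstant.apply_eq_of_preconnectedSpace ?_ x y
  rw [IsLocallyConstant.iff_eventually_eq]
  intro m
  set φ := extChartAt I m
  have hder : ∀ p ∈ φ.target, HasFDerivAt (f ∘ φ.symm) (0 : E →L[ℝ] ℝ) p := by
    intro p hp
    have h1 : MDifferentiableAt 𝓘(ℝ, E) I φ.symm p :=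
      ((contMDiffOn_extChartAt_symm (I := I) (n := ∞) m).contMDiffAt
        ((isOpen_extChartAt_target m).mem_nhds hp)).mdifferentiableAt (by simp)
    have h2 := (hf (φ.symm p)).comp p h1.hasMFDerivAt
    exact (h2.congr_mfderiv (ContinuousLinearMap.zero_comp _)).hasFDerivAt
  obtain ⟨r, hr, hball⟩ := Metric.isOpen_iff.1 (isOpen_extChartAt_target (I := I) m) (φ m)
    (mem_extChartAt_target m)
  have hconst : ∀ p ∈ Metric.ball (φ m) r, (f ∘ φ.symm) p = (f ∘ φ.symm) (φ m) := by
    intro p hp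
    refine Metric.isOpen_ball.is_const_of_fderiv_eq_zero (convex_ball _ _).isPreconnected
      (fun q hq => (hder q (hball hq)).differentiableAt.differentiableWithinAt)
      (fun q hq => (hder q (hball hq)).fderiv) hp (Metric.mem_ball_self hr)
  filter_upwards [(continuousAt_extChartAt (I := I) m) (Metric.ball_mem_nhds (φ m) hr),
    extChartAt_source_mem_nhds (I := I) m] with q hq hqs
  have := hconst (φ q) hq
  simp only [Function.comp_apply] at this
  rwa [φ.left_inv hqs, φ.left_inv (mem_extChartAt_source m)] at this

/-- A smooth vector field has a smooth integral curve through each point. -/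
theorem IsSmoothFieldOn.exists_integralCurve [CompleteSpace E] {v : ∀ m : M, TangentSpace I m}
    (hv : IsSmoothFieldOn Set.univ v) (m : M) :
    ∃ ε > 0, ∃ c : ℝ → M, c 0 = m ∧ ContMDiffOn 𝓘(ℝ, ℝ) I ∞ c (Set.Ioo (-ε) ε) ∧
      ∀ t ∈ Set.Ioo (-ε) ε, modelMFDeriv 𝓘(ℝ, ℝ) I c t 1 = (v (c t) : E) := by
  have hv1 : ContMDiffAt I I.tangent ∞ (fun m => (⟨m, v m⟩ : TangentBundle I M)) m :=
    hv.contMDiffAt univ_mem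
  obtain ⟨c, rfl, hc⟩ := exists_isMIntegralCurveAt_of_contMDiffAt_boundaryless (I := I) 0
    (hv1.of_le (m := 1) (by exact_mod_cast le_top))
  let φ := extChartAt I (c 0)
  have hsrc : ∀ᶠ t in 𝓝 (0 : ℝ), c t ∈ φ.source :=
    hc.continuousAt.preimage_mem_nhds (extChartAt_source_mem_nhds (I := I) _)
  obtain ⟨ε, hε, h⟩ := Metric.eventually_nhds_iff_ball.1
    ((hc.and hc.eventually_hasDerivAt).and hsrc)
  rw [Real.ball_eq_Ioo, zero_sub, zero_add] at h
  refine ⟨ε, hε, c, rfl, ?_, ?_⟩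
  · let w : M → E := fun p => (trivializationAt E (TangentSpace I) (c 0) ⟨p, v p⟩).2
    have hbase : (trivializationAt E (TangentSpace I) (c 0)).baseSet = φ.source := by
      simp [φ]
    have hw : ContMDiffOn I 𝓘(ℝ, E) ∞ w φ.source := by
      rw [← hbase]
      exact ((trivializationAt E (TangentSpace I) (c 0)).contMDiffOn_section_baseSet_iff).1
        (hv.mono (Set.subset_univ _))
    have hder : ∀ t ∈ Set.Ioo (-ε) ε, HasDerivAt (φ ∘ c) (w (c t)) t := fun t ht => (h t ht).1.2
    have hcφ : ∀ t ∈ Set.Ioo (-ε) ε, c t = φ.symm ((φ ∘ c) t) := fun t ht =>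
      (φ.left_inv (h t ht).2).symm
    have hlift : ∀ n : ℕ, ContDiffOn ℝ n (φ ∘ c) (Set.Ioo (-ε) ε) →
        ContMDiffOn 𝓘(ℝ, ℝ) I n c (Set.Ioo (-ε) ε) := by
      intro n hn
      refine ContMDiffOn.congr ?_ hcφ
      exact ((contMDiffOn_extChartAt_symm (I := I) (n := ∞) (c 0)).of_le
        (by exact_mod_cast le_top)).comp hn.contMDiffOn fun t ht => φ.map_source (h t ht).2
    have hn : ∀ n : ℕ, ContDiffOn ℝ n (φ ∘ c) (Set.Ioo (-ε) ε) := by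
      intro n
      induction n with
      | zero =>
        exact contDiffOn_zero.2 fun t ht => (hder t ht).continuousAt.continuousWithinAt
      | succ n ih =>
        push_cast
        rw [contDiffOn_succ_iff_deriv_of_isOpen isOpen_Ioo]
        refine ⟨fun t ht => (hder t ht).differentiableAt.differentiableWithinAt,
          fun hω => absurd hω (by simp), ?_⟩
        refine ContDiffOn.congr ?_ fun t ht => (hder t ht).deriv
        exact ((hw.of_le (by exact_mod_cast le_top)).comp (hlift n ih)
          fun t ht => (h t ht).2).contDiffOn
    exact contMDiffOn_infty.2 fun n => hlift n (hn n)
  · intro t ht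
    have h1 : modelMFDeriv 𝓘(ℝ, ℝ) I c t = (1 : ℝ →L[ℝ] ℝ).smulRight (v (c t) : E) :=
      (h t ht).1.1.mfderiv
    rw [h1]
    exact one_smul ℝ (show E from v (c t))

end Curves

section Product

variable {E : Type*} [NormedAddCommGroup E] [NormedSpace ℝ E]
  {H : Type*} [TopologicalSpace H] {I : ModelWithCorners ℝ E H}
  {F : Type*} [NormedAddCommGroup F] [NormedSpace ℝ F]
  {G : Type u} [TopologicalSpace G] [ChartedSpace H G] [Group G] [LieGroup I ∞ G]

theorem modelMFDeriv_mul {f g : F → G} {t : F} (hf : MDifferentiableAt 𝓘(ℝ, F) I f t)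
    (hg : MDifferentiableAt 𝓘(ℝ, F) I g t) :
    modelMFDeriv 𝓘(ℝ, F) I (fun s => f s * g s) t =
      (rightDeriv I (g t) (f t)).comp (modelMFDeriv 𝓘(ℝ, F) I f t) +
        (leftDeriv I (f t) (g t)).comp (modelMFDeriv 𝓘(ℝ, F) I g t) := by
  have h1 := modelMFDeriv_comp 𝓘(ℝ, F) (I.prod I) I (g := fun x : G × G => x.1 * x.2)
    (f := fun s => (f s, g s)) t ((contMDiff_mul I ∞).contMDiffAt.mdifferentiableAt (by simp))
    (hf.prodMk hg)
  have h2 : modelMFDeriv 𝓘(ℝ, F) (I.prod I) (fun s => (f s, g s)) t =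
      (modelMFDeriv 𝓘(ℝ, F) I f t).prod (modelMFDeriv 𝓘(ℝ, F) I g t) := mfderiv_prodMk hf hg
  rw [h1, h2, mfderiv_mul_eq]
  ext x
  simp

/-- The map `f` is smooth on `Ω` and tangent to the distribution `Δ`. -/
structure IsTangentOn (Δ : G → Submodule ℝ E) (Ω : Set F) (f : F → G) : Prop where
  contMDiffOn : ContMDiffOn 𝓘(ℝ, F) I ∞ f Ω
  mem : ∀ t ∈ Ω, ∀ x, modelMFDeriv 𝓘(ℝ, F) I f t x ∈ Δ (f t)

end Product

namespace DiracStructure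

section Tangent

variable {E : Type*} [NormedAddCommGroup E] [NormedSpace ℝ E]
  {H : Type*} [TopologicalSpace H] {I : ModelWithCorners ℝ E H}
  {F : Type*} [NormedAddCommGroup F] [NormedSpace ℝ F]
  {G : Type u} [TopologicalSpace G] [ChartedSpace H G] [Group G] [LieGroup I ∞ G]
  {D : DiracStructure I G} (hD : D.IsMultiplicative)
include hD

theorem IsMultiplicative.isTangentOn_mul {Ω : Set F} (hΩ : IsOpen Ω) {f g : F → G}
    (hf : IsTangentOn (I := I) D.modelG₀ Ω f) (hg : IsTangentOn (I := I) D.modelG₀ Ω g) :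
    IsTangentOn (I := I) D.modelG₀ Ω (fun t => f t * g t) := by
  refine ⟨hf.contMDiffOn.mul hg.contMDiffOn, fun t ht x => ?_⟩
  rw [modelMFDeriv_mul ((hf.contMDiffOn.contMDiffAt (hΩ.mem_nhds ht)).mdifferentiableAt (by simp))
    ((hg.contMDiffOn.contMDiffAt (hΩ.mem_nhds ht)).mdifferentiableAt (by simp))]
  exact Submodule.add_mem _ (hD.rightDeriv_mem _ (hf.mem t ht x))
    (hD.leftDeriv_mem _ (hg.mem t ht x))

/-- The product of maps tangent to `G₀` that send `0` to the neutral element. -/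
theorem IsMultiplicative.isTangentOn_list_prod {Ω : Set F} (hΩ : IsOpen Ω) (h0 : (0 : F) ∈ Ω)
    {ι : Type*} {f : ι → F → G} (hf : ∀ i, IsTangentOn (I := I) D.modelG₀ Ω (f i))
    (hf0 : ∀ i, f i 0 = 1) (l : List ι) :
    IsTangentOn (I := I) D.modelG₀ Ω (fun t => (l.map fun i => f i t).prod) ∧
      (l.map fun i => f i 0).prod = 1 ∧
      modelMFDeriv 𝓘(ℝ, F) I (fun t => (l.map fun i => f i t).prod) 0 =
        (l.map fun i => modelMFDeriv 𝓘(ℝ, F) I (f i) 0).sum := by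
  induction l with
  | nil =>
    have h : ∀ t : F, modelMFDeriv 𝓘(ℝ, F) I (fun _ : F => (1 : G)) t = 0 := fun t =>
      mfderiv_const
    refine ⟨⟨contMDiffOn_const, fun t _ x => ?_⟩, rfl, h 0⟩
    simp only [List.map_nil, List.prod_nil]
    rw [h]
    exact Submodule.zero_mem _
  | cons i l ih =>
    simp only [List.map_cons, List.prod_cons, List.sum_cons]
    refine ⟨hD.isTangentOn_mul hΩ (hf i) ih.1, by rw [hf0, ih.2.1, one_mul], ?_⟩
    rw [modelMFDeriv_mul
      (((hf i).contMDiffOn.contMDiffAt (hΩ.mem_nhds h0)).mdifferentiableAt (by simp))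
      ((ih.1.contMDiffOn.contMDiffAt (hΩ.mem_nhds h0)).mdifferentiableAt (by simp)),
      ih.2.1, ih.2.2, hf0, rightDeriv_one, leftDeriv_one]
    rfl

/-- A map tangent to `G₀` with prescribed values of its derivative at the neutral element. -/
theorem IsMultiplicative.exists_isTangentOn [CompleteSpace E] [I.Boundaryless] {k : ℕ}
    (v : Fin k → E) (hv : ∀ i, v i ∈ D.modelG₀ 1) :
    ∃ Ω : Set (EuclideanSpace ℝ (Fin k)), IsOpen Ω ∧ 0 ∈ Ω ∧
      ∃ f : EuclideanSpace ℝ (Fin k) → G, IsTangentOn (I := I) D.modelG₀ Ω f ∧ f 0 = 1 ∧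
        ∀ x, modelMFDeriv 𝓘(ℝ, EuclideanSpace ℝ (Fin k)) I f 0 x = ∑ i, x i • v i := by
  choose ε hε c hc0 hc hcd using fun i =>
    (isSmoothFieldOn_leftDeriv (I := I) (G := G) (v i) Set.univ).exists_integralCurve (1 : G)
  let p : Fin k → EuclideanSpace ℝ (Fin k) →L[ℝ] ℝ := fun i => EuclideanSpace.proj i
  let Ω : Set (EuclideanSpace ℝ (Fin k)) := ⋂ i, p i ⁻¹' Set.Ioo (-ε i) (ε i)
  have hΩ : IsOpen Ω := isOpen_iInter_of_finite fun i => isOpen_Ioo.preimage (p i).continuous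
  have h0 : (0 : EuclideanSpace ℝ (Fin k)) ∈ Ω :=
    Set.mem_iInter.2 fun i => by simpa using hε i
  have hder : ∀ i, ∀ t ∈ Ω, ∀ x, modelMFDeriv 𝓘(ℝ, EuclideanSpace ℝ (Fin k)) I
      (fun t => c i (p i t)) t x = x i • leftDeriv I (c i (p i t)) 1 (v i) := by
    intro i t ht x
    have hti := Set.mem_iInter.1 ht i
    have h1 := modelMFDeriv_comp 𝓘(ℝ, EuclideanSpace ℝ (Fin k)) 𝓘(ℝ, ℝ) I (g := c i) (f := p i) t
      (((hc i).contMDiffAt (isOpen_Ioo.mem_nhds hti)).mdifferentiableAt (by simp))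
      (p i).hasMFDerivAt.mdifferentiableAt
    have h2 : modelMFDeriv 𝓘(ℝ, EuclideanSpace ℝ (Fin k)) 𝓘(ℝ, ℝ) (p i) t = p i :=
      (p i).hasMFDerivAt.mfderiv
    rw [h1, h2, ContinuousLinearMap.comp_apply, ← hcd i _ hti, ← map_smul]
    congr 1
    simp [p]
  have hf : ∀ i, IsTangentOn (I := I) D.modelG₀ Ω (fun t => c i (p i t)) := by
    intro i
    refine ⟨(hc i).comp (p i).contMDiff.contMDiffOn fun t ht => Set.mem_iInter.1 ht i,
      fun t ht x => ?_⟩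
    rw [hder i t ht]
    have := hD.leftDeriv_mem (c i (p i t)) (hv i)
    rw [mul_one] at this
    exact Submodule.smul_mem _ _ this
  have hf0 : ∀ i, c i (p i 0) = 1 := fun i => by rw [map_zero, hc0]
  obtain ⟨h1, h2, h3⟩ := hD.isTangentOn_list_prod hΩ h0 hf hf0 (List.finRange k)
  refine ⟨Ω, hΩ, h0, _, h1, h2, fun x => ?_⟩
  rw [h3, ← Fin.sum_univ_def, sum_apply]
  refine Finset.sum_congr rfl fun i _ => ?_
  rw [hder i 0 h0, hf0, leftDeriv_one]
  rfl

end Tangent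

end DiracStructure

section Immersion

open Filter Topology

variable {E : Type*} [NormedAddCommGroup E] [NormedSpace ℝ E] [FiniteDimensional ℝ E]
  {H : Type*} [TopologicalSpace H] {I : ModelWithCorners ℝ E H}
  {F : Type*} [NormedAddCommGroup F] [NormedSpace ℝ F] [FiniteDimensional ℝ F]
  {M : Type*} [TopologicalSpace M] [ChartedSpace H M] [IsManifold I ∞ M]

/-- A map that is immersive at `0` is an injective immersion near `0`. -/
theorem ContMDiffOn.exists_ball_injOn {f : F → M} {Ω : Set F}
    (hf : ContMDiffOn 𝓘(ℝ, F) I ∞ f Ω) (hΩ : IsOpen Ω) (h0 : (0 : F) ∈ Ω)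
    (hinj : Function.Injective (modelMFDeriv 𝓘(ℝ, F) I f 0)) :
    ∃ r > 0, Metric.ball 0 r ⊆ Ω ∧ Set.InjOn f (Metric.ball 0 r) ∧
      ∀ t ∈ Metric.ball (0 : F) r, Function.Injective (modelMFDeriv 𝓘(ℝ, F) I f t) := by
  have : CompleteSpace F := FiniteDimensional.complete ℝ F
  set φ := extChartAt I (f 0) with hφ
  have hφd : ∀ y ∈ φ.source, MDifferentiableAt I 𝓘(ℝ, E) φ y := by
    intro y hy
    rw [hφ, extChartAt_source] at hy
    exact mdifferentiableAt_extChartAt hy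
  have hφinj : Function.Injective (modelMFDeriv I 𝓘(ℝ, E) φ (f 0)) :=
    (isInvertible_mfderiv_extChartAt (mem_extChartAt_source (I := I) (f 0))).injective
  let T : F →L[ℝ] E :=
    (modelMFDeriv I 𝓘(ℝ, E) φ (f 0)).comp (modelMFDeriv 𝓘(ℝ, F) I f 0)
  obtain ⟨C', hC'⟩ := (T : F →ₗ[ℝ] E).exists_leftInverse_of_injective
    (LinearMap.ker_eq_bot.2 (hφinj.comp hinj))
  let C : E →L[ℝ] F := LinearMap.toContinuousLinearMap C'
  have hC : C.comp T = .id ℝ F := ContinuousLinearMap.ext fun x => LinearMap.congr_fun hC' x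
  let h : F → F := fun t => C (φ (f t))
  let Ω' : Set F := Ω ∩ f ⁻¹' φ.source
  have hΩ' : IsOpen Ω' :=
    hf.continuousOn.isOpen_inter_preimage hΩ (isOpen_extChartAt_source (f 0))
  have h0' : (0 : F) ∈ Ω' := ⟨h0, mem_extChartAt_source (f 0)⟩
  have hh : ContDiffOn ℝ ∞ h Ω' := by
    refine ContMDiffOn.contDiffOn ?_
    refine C.contMDiff.comp_contMDiffOn ?_
    exact (contMDiffOn_extChartAt (I := I) (n := ∞) (x := f 0)).comp
      (hf.mono Set.inter_subset_left) fun t ht => by simpa [hφ, extChartAt_source] using ht.2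
  have hder : ∀ t ∈ Ω', fderiv ℝ h t = (C.comp (modelMFDeriv I 𝓘(ℝ, E) φ (f t))).comp
      (modelMFDeriv 𝓘(ℝ, F) I f t) := by
    intro t ht
    have hft := (hf.contMDiffAt (hΩ.mem_nhds ht.1)).mdifferentiableAt (by simp)
    have h1 := modelMFDeriv_comp 𝓘(ℝ, F) I 𝓘(ℝ, E) t (hφd _ ht.2) hft
    have h2 := modelMFDeriv_comp 𝓘(ℝ, F) 𝓘(ℝ, E) 𝓘(ℝ, F) (g := C) (f := fun s => φ (f s)) t
      C.hasMFDerivAt.mdifferentiableAt ((hφd _ ht.2).comp t hft)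
    have h3 : modelMFDeriv 𝓘(ℝ, E) 𝓘(ℝ, F) C (φ (f t)) = C := C.hasMFDerivAt.mfderiv
    rw [ContinuousLinearMap.comp_assoc, ← h1]
    rw [h3] at h2
    rw [← h2]
    exact mfderiv_eq_fderiv.symm
  have hder0 : fderiv ℝ h 0 = .id ℝ F := by
    rw [hder 0 h0', ContinuousLinearMap.comp_assoc]
    exact hC
  have hh0 : ContDiffAt ℝ ∞ h 0 := hh.contDiffAt (hΩ'.mem_nhds h0')
  have hfd : HasFDerivAt h ((ContinuousLinearEquiv.refl ℝ F : F ≃L[ℝ] F) : F →L[ℝ] F) 0 := by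
    have := (hh0.differentiableAt (by simp)).hasFDerivAt
    rwa [hder0] at this
  let e := hh0.toOpenPartialHomeomorph h hfd (by simp)
  have he : ∀ᶠ t in 𝓝 (0 : F), t ∈ e.source :=
    e.open_source.mem_nhds (hh0.mem_toOpenPartialHomeomorph_source hfd (by simp))
  have hunit : ∀ᶠ t in 𝓝 (0 : F), IsUnit (fderiv ℝ h t) := by
    have hcont : ContinuousAt (fderiv ℝ h) 0 :=
      (hh.continuousOn_fderiv_of_isOpen hΩ' (by simp)).continuousAt (hΩ'.mem_nhds h0')
    refine hcont.eventually (IsOpen.mem_nhds (Units.isOpen (R := F →L[ℝ] F)) ?_)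
    rw [hder0]
    exact isUnit_one
  obtain ⟨r, hr, hball⟩ := Metric.eventually_nhds_iff_ball.1
    ((he.and hunit).and (hΩ'.mem_nhds h0'))
  refine ⟨r, hr, fun t ht => (hball t ht).2.1, ?_, ?_⟩
  · intro s hs t ht hst
    refine e.injOn (hball s hs).1.1 (hball t ht).1.1 ?_
    exact congrArg (fun y => C (φ y)) hst
  · intro t ht
    obtain ⟨u, hu⟩ := (hball t ht).1.2
    rw [hder t (hball t ht).2] at hu
    refine Function.Injective.of_comp (f := C.comp (modelMFDeriv I 𝓘(ℝ, E) φ (f t))) ?_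
    have hinjU : Function.Injective (u : F →L[ℝ] F) := by
      refine Function.LeftInverse.injective (g := ((u⁻¹ : (F →L[ℝ] F)ˣ) : F →L[ℝ] F)) fun x => ?_
      exact DFunLike.congr_fun u.inv_mul x
    rw [hu] at hinjU
    exact hinjU

end Immersion

namespace DiracStructure

section Leaf

variable {E : Type*} [NormedAddCommGroup E] [NormedSpace ℝ E] [FiniteDimensional ℝ E]
  {H : Type*} [TopologicalSpace H] {I : ModelWithCorners ℝ E H} [I.Boundaryless]
  {G : Type u} [TopologicalSpace G] [ChartedSpace H G] [Group G] [LieGroup I ∞ G]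
  {D : DiracStructure I G}

/-- There is an integral manifold of `G₀` through the neutral element. -/
theorem IsMultiplicative.exists_isConnectedIntegralManifold (hD : D.IsMultiplicative) :
    ∃ (k : ℕ) (S : Type u) (_ : TopologicalSpace S)
      (_ : ChartedSpace (EuclideanSpace ℝ (Fin k)) S) (ι : S → G),
      IsConnectedIntegralManifold (k := k) D.G₀ ι ∧ (1 : G) ∈ Set.range ι := by
  have : CompleteSpace E := FiniteDimensional.complete ℝ E
  let k := Module.finrank ℝ (D.modelG₀ (1 : G))
  let F := EuclideanSpace ℝ (Fin k)
  let b := Module.finBasis ℝ (D.modelG₀ (1 : G))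
  obtain ⟨Ω, hΩ, h0, f, hf, hf0, hfd⟩ :=
    hD.exists_isTangentOn (fun i => (b i : E)) fun i => (b i).2
  have hinj : Function.Injective (modelMFDeriv 𝓘(ℝ, F) I f 0) := by
    rw [injective_iff_map_eq_zero]
    intro x hx
    rw [hfd] at hx
    have hli : LinearIndependent ℝ fun i => (b i : E) :=
      b.linearIndependent.map' (D.modelG₀ (1 : G)).subtype (Submodule.ker_subtype _)
    ext i
    exact Fintype.linearIndependent_iff.1 hli (fun i => x i) hx i
  obtain ⟨r, hr, hball, hinjOn, himm⟩ := hf.contMDiffOn.exists_ball_injOn hΩ h0 hinj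
  let S := ULift.{u} (Metric.ball (0 : F) r)
  let j : S → F := fun s => s.down.1
  have hj : Topology.IsOpenEmbedding j :=
    (Metric.isOpen_ball.isOpenEmbedding_subtypeVal).comp Homeomorph.ulift.isOpenEmbedding
  have hjball : ∀ s, j s ∈ Metric.ball (0 : F) r := fun s => s.down.2
  have : Nonempty S := ⟨⟨⟨0, Metric.mem_ball_self hr⟩⟩⟩
  let _ : ChartedSpace F S := hj.singletonChartedSpace
  have hS : IsManifold (𝓡 k) ∞ S := hj.isManifold_singleton
  have hjs : ContMDiff (𝓡 k) (𝓡 k) ∞ j := contMDiff_isOpenEmbedding hj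
  have hjinj : ∀ s, Function.Injective (modelMFDeriv (𝓡 k) (𝓡 k) j s) := by
    intro s
    have h1 := (isInvertible_mfderiv_extChartAt (I := 𝓡 k) (mem_extChartAt_source s)).injective
    have h2 : (extChartAt (𝓡 k) s : S → F) = j := by
      ext t : 1
      simp [extChartAt]
    rw [h2] at h1
    exact h1
  have hfs : ∀ s, MDifferentiableAt (𝓡 k) I f (j s) := fun s =>
    (hf.contMDiffOn.contMDiffAt (hΩ.mem_nhds (hball (hjball s)))).mdifferentiableAt (by simp)
  have hder : ∀ s, modelMFDeriv (𝓡 k) I (fun s => f (j s)) s =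
      (modelMFDeriv (𝓡 k) I f (j s)).comp (modelMFDeriv (𝓡 k) (𝓡 k) j s) := fun s =>
    modelMFDeriv_comp (𝓡 k) (𝓡 k) I s (hfs s) (hjs.contMDiffAt.mdifferentiableAt (by simp))
  have hderinj : ∀ s, Function.Injective (modelMFDeriv (𝓡 k) I (fun s => f (j s)) s) := by
    intro s
    rw [hder]
    exact (himm _ (hjball s)).comp (hjinj s)
  have hrange : ∀ s, LinearMap.range
      (modelMFDeriv (𝓡 k) I (fun s => f (j s)) s : F →ₗ[ℝ] E) = D.modelG₀ (f (j s)) := by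
    intro s
    refine Submodule.eq_of_le_of_finrank_eq ?_ ?_
    · rintro _ ⟨x, rfl⟩
      rw [hder]
      exact hf.mem _ (hball (hjball s)) _
    · rw [LinearMap.finrank_range_of_inj (hderinj s), hD.finrank_modelG₀]
      simp [k]
  refine ⟨k, S, inferInstance, inferInstance, fun s => f (j s), ?_,
    ⟨⟨⟨0, Metric.mem_ball_self hr⟩⟩, hf0⟩⟩
  exact
    { isManifold := hS
      t2Space := hj.isEmbedding.t2Space
      secondCountableTopology := hj.isEmbedding.secondCountableTopology
      connectedSpace := by
        have : ConnectedSpace (Metric.ball (0 : F) r) :=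
          isConnected_iff_connectedSpace.1
            ((convex_ball 0 r).isConnected ⟨0, Metric.mem_ball_self hr⟩)
        exact Homeomorph.ulift.symm.surjective.connectedSpace Homeomorph.ulift.symm.continuous
      contMDiff := hf.contMDiffOn.comp_contMDiff hjs fun s => hball (hjball s)
      injective := fun s t hst => hj.injective (hinjOn (hjball s) (hjball t) hst)
      injective_mfderiv := hderinj
      range_mfderiv := fun s => congrArg SetLike.coe (hrange s) }

end Leaf

end DiracStructure

namespace DiracStructure

section Main

variable {E : Type*} [NormedAddCommGroup E] [NormedSpace ℝ E] [FiniteDimensional ℝ E]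
  {H : Type*} [TopologicalSpace H] {I : ModelWithCorners ℝ E H}
  {G : Type u} [TopologicalSpace G] [ChartedSpace H G] [Group G] [LieGroup I ∞ G]
  {D : DiracStructure I G} (hD : D.IsMultiplicative)
include hD

/-- The derivative of the cocycle along an integral manifold of `G₀`. -/
theorem IsMultiplicative.hasMFDerivAt_cocycle_comp {k : ℕ} {S : Type*} [TopologicalSpace S]
    [ChartedSpace (EuclideanSpace ℝ (Fin k)) S] {ι : S → G}
    (hι : IsConnectedIntegralManifold (k := k) D.G₀ ι) {ξ η : E →L[ℝ] ℝ}
    (hξ : ξ ∈ D.modelP₁ 1) (hη : η ∈ D.modelP₁ 1) (s : S) :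
    HasMFDerivAt (𝓡 k) 𝓘(ℝ, ℝ) (fun s => D.cocycle ξ η (ι s)) s
      (((D.modelBracket ((ξ.comp (leftDeriv I (ι s)⁻¹ (ι s))).comp (rightDeriv I (ι s) 1))
        ((η.comp (leftDeriv I (ι s)⁻¹ (ι s))).comp (rightDeriv I (ι s) 1))).comp
          (rightDeriv I (ι s)⁻¹ (ι s))).comp (modelMFDeriv (𝓡 k) I ι s) :
        EuclideanSpace ℝ (Fin k) →L[ℝ] ℝ) :=
  (hD.hasMFDerivAt_cocycle hξ hη (ι s)).comp s
    ((hι.contMDiff s).mdifferentiableAt (by simp)).hasMFDerivAt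

/-- If `𝔭₁` is closed under the bracket, then `D` is vertical along the leaf of `G₀`. -/
theorem IsMultiplicative.isVerticalAt_of_bracket_mem
    (h : ∀ ξ ∈ D.modelP₁ 1, ∀ η ∈ D.modelP₁ 1, D.modelBracket ξ η ∈ D.modelP₁ 1) {n : G}
    (hn : n ∈ integralLeaf D.G₀ (1 : G)) : D.IsVerticalAt n := by
  obtain ⟨k, S, _, _, ι, hι, ⟨s₀, hs₀⟩, ⟨s₁, rfl⟩⟩ := hn
  have := hι.isManifold
  have := hι.connectedSpace
  refine hD.isVerticalAt_iff.2 fun ξ hξ η hη => ?_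
  rw [← hD.cocycle_one hξ hη, ← hs₀]
  refine eq_of_hasMFDerivAt_eq_zero (I := 𝓡 k) (f := fun s => D.cocycle ξ η (ι s)) (fun s => ?_) _ _
  refine (hD.hasMFDerivAt_cocycle_comp hι hξ hη s).congr_mfderiv ?_
  refine ContinuousLinearMap.ext fun x => ?_
  have hx : modelMFDeriv (𝓡 k) I ι s x ∈ D.modelG₀ (ι s) := by
    have : mfderiv (𝓡 k) I ι s x ∈ Set.range (mfderiv (𝓡 k) I ι s) := ⟨x, rfl⟩
    rw [hι.range_mfderiv s] at this
    exact this
  have h1 := hD.rightDeriv_mem (ι s)⁻¹ hx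
  rw [mul_inv_cancel] at h1
  exact mem_modelG₀_iff.1 h1 _ (h _ (hD.coadjoint_mem hξ _) _ (hD.coadjoint_mem hη _))

/-- If `D` is vertical along the leaf of `G₀`, then `𝔭₁` is closed under the bracket. -/
theorem IsMultiplicative.bracket_mem_of_isVerticalAt [I.Boundaryless]
    (h : ∀ n ∈ integralLeaf D.G₀ (1 : G), D.IsVerticalAt n) {ξ η : E →L[ℝ] ℝ}
    (hξ : ξ ∈ D.modelP₁ 1) (hη : η ∈ D.modelP₁ 1) : D.modelBracket ξ η ∈ D.modelP₁ 1 := by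
  obtain ⟨k, S, _, _, ι, hι, ⟨s₀, hs₀⟩⟩ := hD.exists_isConnectedIntegralManifold
  have hzero : (fun s => D.cocycle ξ η (ι s)) = fun _ => 0 := by
    funext s
    exact hD.isVerticalAt_iff.1
      (h (ι s) ⟨k, S, inferInstance, inferInstance, ι, hι, ⟨s₀, hs₀⟩, ⟨s, rfl⟩⟩) ξ hξ η hη
  have h1 := hD.hasMFDerivAt_cocycle_comp hι hξ hη s₀
  rw [hzero] at h1
  have h2 := hasMFDerivAt_unique h1 (hasMFDerivAt_const (I := 𝓡 k) (I' := 𝓘(ℝ, ℝ)) (0 : ℝ) s₀)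
  have hr : ∀ v ∈ D.modelG₀ (ι s₀), ∃ x, modelMFDeriv (𝓡 k) I ι s₀ x = v := by
    intro v hv
    have : v ∈ Set.range (mfderiv (𝓡 k) I ι s₀) := by
      rw [hι.range_mfderiv s₀]
      exact hv
    exact this
  refine mem_modelP₁_iff.2 fun v hv => ?_
  rw [← hs₀] at hv
  obtain ⟨x, rfl⟩ := hr v hv
  have h3 := DFunLike.congr_fun h2 x
  rw [hs₀] at h3
  simp only [inv_one, leftDeriv_one, rightDeriv_one, ContinuousLinearMap.comp_id] at h3
  exact h3

end Main

end DiracStructure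

end

theorem mainTheorem5
    {E : Type*} [NormedAddCommGroup E] [NormedSpace ℝ E] [FiniteDimensional ℝ E]
    {H : Type*} [TopologicalSpace H] (I : ModelWithCorners ℝ E H) [I.Boundaryless]
    {G : Type u} [TopologicalSpace G] [ChartedSpace H G] [Group G] [LieGroup I ∞ G]
    (D : DiracStructure I G) (hD : D.IsMultiplicative) :
    -- the bracket on `𝔭₁` is well defined
    (∀ ξ ∈ D.P₁ 1, (∃ X, D.IsLift ξ X) ∧ ∀ η ∈ D.P₁ 1, ∀ X, D.IsLift ξ X →
      HasMFDerivAt I 𝓘(ℝ, ℝ) (fun g : G => leftInvariantForm η g (X g)) 1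
        (D.dualBracket ξ η)) ∧
    -- invariance under right translations by `N`
    ((∀ n ∈ integralLeaf D.G₀ 1, D.IsPreservedBy (fun g => g * n)) ↔
      ∀ ξ ∈ D.P₁ 1, ∀ η ∈ D.P₁ 1, D.dualBracket ξ η ∈ D.P₁ 1) ∧
    -- invariance under left translations by `N`
    ((∀ n ∈ integralLeaf D.G₀ 1, D.IsPreservedBy (fun g => n * g)) ↔
      ∀ ξ ∈ D.P₁ 1, ∀ η ∈ D.P₁ 1, D.dualBracket ξ η ∈ D.P₁ 1) := by
  have : CompleteSpace E := FiniteDimensional.complete ℝ E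
  have key : (∀ n ∈ integralLeaf D.G₀ (1 : G), D.IsVerticalAt n) ↔
      ∀ ξ ∈ D.P₁ 1, ∀ η ∈ D.P₁ 1, D.dualBracket ξ η ∈ D.P₁ 1 :=
    ⟨fun h ξ hξ η hη => hD.bracket_mem_of_isVerticalAt h hξ hη,
      fun h n hn => hD.isVerticalAt_of_bracket_mem h hn⟩
  refine ⟨fun ξ hξ => ⟨hD.exists_isLift hξ, fun η hη X hX => hD.hasMFDerivAt_lift hξ hη hX⟩,
    ?_, ?_⟩
  · rw [← key]
    exact forall₂_congr fun n _ => hD.isPreservedBy_mul_right_iff n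
  · rw [← key]
    exact forall₂_congr fun n _ => hD.isPreservedBy_mul_left_iff n
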